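/- Let $d\ge 1$, let $I_\pm=\{\pm1,\dots,\pm d\}$ label the canonical basis $|\tau\rangle$ of $\mathbb C^{2d}$, and let $r:I_\pm\to\mathbb Z^d$ be any function, with mean $\overline r=\frac1{2d}\sum_{\tau}r(\tau)$. On $\mathbb C^{2d}\otimes\ell^2(\mathbb Z^d)$ let $S=\sum_{x\in\mathbb Z^d}\sum_{\tau\in I_\pm}|\tau\rangle\langle\tau|\otimes|x+r(\tau)\rangle\langle x|$. Let $C(\omega)$ be a random unitary $2d\times 2d$ matrix on a probability space $(\Omega,\mu)$, and let $\overline\omega=(\omega_1,\omega_2,\dots)$ be distributed according to the product measure $\mu^{\otimes\mathbb N^*}$, with expectation $\mathbb E$. Set $U_{\overline\omega}(n,0)=U_n\cdots U_1$, $U_k=S(C(\omega_k)\otimes\mathbb I)$. Let $\rho_0$ be a density matrix on $\mathbb C^{2d}\otimes\ell^2(\mathbb Z^d)$ (a non-negative operator of trace one) with kernel $\rho_0(x,y)\in M_{2d}(\mathbb C)$, $\rho_0(x,y)_{\sigma\tau}=\langle\sigma\otimes x|\rho_0|\tau\otimes y\rangle$, such that $\sum_{x,y\in\mathbb Z^d}\|\rho_0(x,y)\|<\infty$.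 Let $\rho_n^{\overline\omega}=U_{\overline\omega}(n,0)\rho_0U_{\overline\omega}(n,0)^*$, and define the averaged position distribution and its characteristic function by $$w_z(n)=\mathbb E\big(\mathrm{Tr}\,\rho^{\overline\omega}_n(z,z)\big),\qquad \Phi_n^{\rho_0}(y)=\sum_{z\in\mathbb Z^d}w_z(n)e^{iyz}\quad(y\in\mathbb R^d).$$ For $y,y'\in\mathbb R^d$ put $D(y,y')=\sum_{\tau,\tau'}e^{i(yr(\tau)+y'r(\tau'))}|\tau\otimes\tau'\rangle\langle\tau\otimes\tau'|$ and $\mathcal M(y,y')=D(y,y')\,\mathbb E\big(C(\omega)\otimes\overline{C(\omega)}\big)$ on $\mathbb C^{2d}\otimes\mathbb C^{2d}$; $\Psi_1=\sum_\tau|\tau\otimes\tau\rangle$, $P=\frac1{2d}|\Psi_1\rangle\langle\Psi_1|$; and $$R_0(y,y')=\sum_{k,k'\in\mathbb Z^d}e^{i(yk+y'k')}\rho_0(k,k'),\qquad \mathbf R_0(y,y')=\sum_{\tau,\tau'}\langle\tau|R_0(y,y')\tau'\rangle\,|\tau\otimes\tau'\rangle .$$ Assumption S: for all $v\in[0,2\pi)^d$,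 $1$ is the only point of the spectrum of $\mathcal M(-v,v)$ on the unit circle, and it is a simple eigenvalue. Under Assumption S the following hold. (a) For every $v\in\mathbb R^d$ the limit $S_v(1)=\lim_{z\to1}\Big((\mathcal M(-v,v)-z)^{-1}-\frac{P}{1-z}\Big)$ exists. Let $\mathbb D(v)$ be the symmetric $d\times d$ matrix with $$\langle y|\mathbb D(v)y\rangle=-\frac1d\Big(\sum_{\tau}\frac{(yr(\tau))^2}{2}+\sum_{\tau,\tau'}(yr(\tau))(yr(\tau'))\Big\{\langle\tau\otimes\tau|S_v(1)\,\tau'\otimes\tau'\rangle-\frac1{2d}\Big\}\Big)-(y\overline r)^2 .$$ (b) For every $v\in\mathbb R^d$, $R_0(-v,v)=\sum_{k,l\in\mathbb Z^d}e^{ivl}\rho_0(k,k+l)$. (c) For every $t\ge0$ and $y\in\mathbb R^d$, $$\lim_{n\to\infty}\Phi^{\rho_0}_{[tn]}(y/n)=e^{ity\overline r},$$ $$\lim_{n\to\infty}e^{-i[tn]\frac{\overline ry}{\sqrt n}}\Phi^{\rho_0}_{[tn]}(y/\sqrt n)=\int_{\mathbb T^d}e^{-\frac t2\langle y|\mathbb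 D(v)y\rangle}\langle\Psi_1|\mathbf R_0(-v,v)\rangle\,d\tilde v=\int_{\mathbb T^d}e^{-\frac t2\langle y|\mathbb D(v)y\rangle}\,\mathrm{Tr}\,R_0(-v,v)\,d\tilde v,$$ where $\mathbb T^d=[0,2\pi)^d$, $d\tilde v=dv/(2\pi)^d$, and the integrands are integrable. -/

import Mathlib

open MeasureTheory Filter Topology Complex
open scoped Matrix Kronecker

namespace QuantumWalk

noncomputable section

/-! ### The Hilbert space of the walker -/

/-- The set `I_± = {±1, …, ±d}` of the `2d` coin labels, the two labels attached to the direction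
`j` being `(j, true)` for `+j` and `(j, false)` for `-j`. -/
abbrev Coin (d : ℕ) : Type := Fin d × Bool

/-- The lattice `ℤ^d`. -/
abbrev Lattice (d : ℕ) : Type := Fin d → ℤ

/-- The internal space `ℂ^{2d}` with its canonical orthonormal basis indexed by `I_±`. -/
abbrev CoinSpace (d : ℕ) : Type := EuclideanSpace ℂ (Coin d)

/-- The Hilbert space `ℂ^{2d} ⊗ ℓ²(ℤ^d)`, realised as `ℓ²(ℤ^d; ℂ^{2d})`:
a vector `ψ` is the family `(ψ(x))_x` with `∑ ‖ψ(x)‖² < ∞`. -/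
abbrev WalkSpace (d : ℕ) : Type := lp (fun _ : Lattice d => CoinSpace d) 2

/-- Complex square matrices indexed by `I_±`. -/
abbrev CoinMatrix (d : ℕ) : Type := Matrix (Coin d) (Coin d) ℂ

/-- Matrices on `ℂ^{2d} ⊗ ℂ^{2d}` in the canonical basis `|τ ⊗ τ'⟩`. -/
abbrev PairMatrix (d : ℕ) : Type := Matrix (Coin d × Coin d) (Coin d × Coin d) ℂ

/-- The basis vector `|τ⟩ ⊗ |x⟩`. -/
def ket {d : ℕ} (τ : Coin d) (x : Lattice d) : WalkSpace d :=
  lp.single 2 x (EuclideanSpace.single τ (1 : ℂ))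

theorem memlp_tensorId {d : ℕ} (A : CoinSpace d →L[ℂ] CoinSpace d) (ψ : WalkSpace d) :
    Memℓp (fun x => A (ψ x)) 2 :=
  Memℓp.mono (((lp.memℓp ψ).norm).const_mul ‖A‖) fun x => A.le_opNorm (ψ x)

/-- The operator `A ⊗ 𝕀`, acting by `(A ⊗ 𝕀) ψ (x) = A (ψ(x))`. -/
def tensorId {d : ℕ} (A : CoinSpace d →L[ℂ] CoinSpace d) : WalkSpace d →L[ℂ] WalkSpace d :=
  LinearMap.mkContinuous
    { toFun := fun ψ => ⟨fun x => A (ψ x), memlp_tensorId A ψ⟩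
      map_add' := fun ψ φ => by ext x : 2; exact map_add A (ψ x) (φ x)
      map_smul' := fun c ψ => by ext x : 2; exact map_smul A c (ψ x) }
    ‖A‖ (fun ψ => by
      have h : ‖((⟨fun x => A (ψ x), memlp_tensorId A ψ⟩ : WalkSpace d))‖
          ≤ ‖(‖A‖ : ℂ) • ψ‖ := by
        refine lp.norm_mono (by norm_num) fun x => ?_
        have h2 := A.le_opNorm (ψ x)
        rw [lp.coeFn_smul, Pi.smul_apply, norm_smul]
        simpa using h2
      refine h.trans (le_of_eq ?_)
      rw [norm_smul]
      simp)

theorem memlp_translation {d : ℕ} (k : Lattice d) (ψ : WalkSpace d) :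
    Memℓp (fun x => ψ (x - k)) 2 := by
  refine memℓp_gen ?_
  exact ((Equiv.subRight k).summable_iff
    (f := fun x => ‖ψ x‖ ^ (2 : ENNReal).toReal)).2 ((lp.memℓp ψ).summable (by norm_num))

/-- The operator `𝕀 ⊗ ∑ₓ |x + k⟩⟨x|`, acting by `(T_k ψ)(x) = ψ(x - k)`. -/
def translation {d : ℕ} (k : Lattice d) : WalkSpace d →L[ℂ] WalkSpace d :=
  LinearMap.mkContinuous
    { toFun := fun ψ => ⟨fun x => ψ (x - k), memlp_translation k ψ⟩
      map_add' := fun ψ φ => by ext x : 2; rfl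
      map_smul' := fun c ψ => by ext x : 2; rfl }
    1 (fun ψ => by
      rw [one_mul]
      refine le_of_eq ?_
      rw [lp.norm_eq_tsum_rpow (by norm_num), lp.norm_eq_tsum_rpow (by norm_num)]
      congr 1
      exact (Equiv.subRight k).tsum_eq (fun x => ‖ψ x‖ ^ (2 : ENNReal).toReal))

/-! ### The dynamics -/

/-- The operator on `ℂ^{2d}` with the given matrix in the canonical basis. -/
def coinOp {d : ℕ} (C : CoinMatrix d) : CoinSpace d →L[ℂ] CoinSpace d :=
  Matrix.toEuclideanCLM (𝕜 := ℂ) C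

/-- The shift `S = ∑_τ ∑ₓ P_τ ⊗ |x + r(τ)⟩⟨x|` of the jump function `r`, `P_τ = |τ⟩⟨τ|`. -/
def shift {d : ℕ} (r : Coin d → Lattice d) : WalkSpace d →L[ℂ] WalkSpace d :=
  ∑ τ : Coin d, tensorId (coinOp (Matrix.single τ τ 1)) ∘L translation (r τ)

/-- `U(n,0) = U_n ⋯ U_1` with `U_k = S (C_k ⊗ 𝕀)`; the coin matrix `C_k` of step `k ≥ 1` is
`C (k - 1)`. -/
def evolution {d : ℕ} (r : Coin d → Lattice d) (C : ℕ → CoinMatrix d) :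
    ℕ → (WalkSpace d →L[ℂ] WalkSpace d)
  | 0 => ContinuousLinearMap.id ℂ (WalkSpace d)
  | n + 1 => (shift r ∘L tensorId (coinOp (C n))) ∘L evolution r C n

/-- The density matrix `ρ_n = U(n,0) ρ₀ U(n,0)*` at time `n`. -/
def evolved {d : ℕ} (r : Coin d → Lattice d) (C : ℕ → CoinMatrix d)
    (ρ₀ : WalkSpace d →L[ℂ] WalkSpace d) (n : ℕ) : WalkSpace d →L[ℂ] WalkSpace d :=
  evolution r C n ∘L ρ₀ ∘L (evolution r C n).adjoint

/-- The kernel `ρ(x,y) ∈ M_{2d}(ℂ)`, `ρ_{στ}(x,y) = ⟨σ ⊗ x | ρ | τ ⊗ y⟩`. -/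
def kernel {d : ℕ} (ρ : WalkSpace d →L[ℂ] WalkSpace d) (x y : Lattice d) : CoinMatrix d :=
  Matrix.of fun σ τ => inner ℂ (ket σ x) (ρ (ket τ y))

/-- A density matrix: a non-negative trace class operator of trace one. (A non-negative operator is
trace class as soon as its diagonal is summable in one orthonormal basis.) -/
structure IsDensityMatrix {d : ℕ} (ρ : WalkSpace d →L[ℂ] WalkSpace d) : Prop where
  isPositive : ρ.IsPositive
  hasTrace_one : HasSum (fun x : Lattice d => (kernel ρ x x).trace) 1

/-- `W_z(n) = P(X_n = z) = Tr ρ_n(z,z)`. -/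
def positionProb {d : ℕ} (r : Coin d → Lattice d) (C : ℕ → CoinMatrix d)
    (ρ₀ : WalkSpace d →L[ℂ] WalkSpace d) (n : ℕ) (z : Lattice d) : ℂ :=
  (kernel (evolved r C ρ₀ n) z z).trace

/-! ### The random walk: i.i.d. coins `C(ω₁), C(ω₂), …` -/

/-- The averaged distribution `w_z(n) = 𝔼 (W_z^ω̄(n))`, the expectation being with respect to the
product measure `⨂_k μ` on sequences `ω̄` in `Ω`. -/
def averagedProb {d : ℕ} {Ω : Type*} [MeasurableSpace Ω] (μ : Measure Ω) (C : Ω → CoinMatrix d)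
    (r : Coin d → Lattice d) (ρ₀ : WalkSpace d →L[ℂ] WalkSpace d) (n : ℕ) (z : Lattice d) : ℂ :=
  ∫ ω : ℕ → Ω, positionProb r (fun k => C (ω k)) ρ₀ n z ∂(Measure.infinitePi fun _ : ℕ => μ)

/-- The phase `e^{iyk}`, `yk = ∑_j y_j k_j`. -/
def phase {d : ℕ} (y : Fin d → ℝ) (k : Lattice d) : ℂ :=
  Complex.exp (I * ((∑ j, y j * (k j : ℝ) : ℝ) : ℂ))

/-- The averaged characteristic function `Φ_n^{ρ₀}(y) = ∑_z w_z(n) e^{iyz}`. -/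
def charFn {d : ℕ} {Ω : Type*} [MeasurableSpace Ω] (μ : Measure Ω) (C : Ω → CoinMatrix d)
    (r : Coin d → Lattice d) (ρ₀ : WalkSpace d →L[ℂ] WalkSpace d) (n : ℕ) (y : Fin d → ℝ) : ℂ :=
  ∑' z : Lattice d, averagedProb μ C r ρ₀ n z * phase y z

/-! ### The averaged transfer matrices -/

/-- `ℰ = 𝔼 (C(ω) ⊗ C̄(ω))`, the expectation being taken entrywise. -/
def meanCoin {d : ℕ} {Ω : Type*} [MeasurableSpace Ω] (μ : Measure Ω) (C : Ω → CoinMatrix d) :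
    PairMatrix d :=
  Matrix.of fun S T => ∫ ω, (C ω ⊗ₖ (C ω).map star) S T ∂μ

/-- `D(y,y') = ∑_{τ,τ'} e^{i(y r(τ) + y' r(τ'))} |τ ⊗ τ'⟩⟨τ ⊗ τ'|`. -/
def phaseMatrix {d : ℕ} (r : Coin d → Lattice d) (y y' : Fin d → ℝ) : PairMatrix d :=
  Matrix.diagonal fun T => phase y (r T.1) * phase y' (r T.2)

/-- `ℳ(y,y') = D(y,y') ℰ`. -/
def meanTransfer {d : ℕ} {Ω : Type*} [MeasurableSpace Ω] (μ : Measure Ω) (C : Ω → CoinMatrix d)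
    (r : Coin d → Lattice d) (y y' : Fin d → ℝ) : PairMatrix d :=
  phaseMatrix r y y' * meanCoin μ C

/-- The fundamental box `[0, 2π)^d` representing the torus `𝕋^d`. -/
def torusBox (d : ℕ) : Set (Fin d → ℝ) := Set.univ.pi fun _ => Set.Ico 0 (2 * Real.pi)

/-- Assumption S: for all `v ∈ [0,2π)^d`, `1` is the only point of the spectrum of `ℳ(-v,v)` on the
unit circle, and it is a simple eigenvalue. -/
def AssumptionS {d : ℕ} {Ω : Type*} [MeasurableSpace Ω] (μ : Measure Ω) (C : Ω → CoinMatrix d)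
    (r : Coin d → Lattice d) : Prop :=
  ∀ v ∈ torusBox d,
    spectrum ℂ (meanTransfer μ C r (-v) v) ∩ Metric.sphere 0 1 = {1} ∧
      (meanTransfer μ C r (-v) v).charpoly.rootMultiplicity 1 = 1

/-- `Ψ₁ = ∑_τ |τ ⊗ τ⟩`. -/
def psiOne (d : ℕ) : Coin d × Coin d → ℂ := fun T => if T.1 = T.2 then 1 else 0

/-- The orthogonal projector `P = |Ψ₀⟩⟨Ψ₀|`, `Ψ₀ = Ψ₁ / ‖Ψ₁‖`, where `‖Ψ₁‖² = 2d`. -/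
def projPsi (d : ℕ) : PairMatrix d :=
  (2 * d : ℂ)⁻¹ • Matrix.vecMulVec (psiOne d) (star (psiOne d))

/-- `S_v(z)` for `z ≠ 1`: `(ℳ(-v,v) - z)⁻¹ = P / (1 - z) + S_v(z)`. -/
def reducedResolvent {d : ℕ} {Ω : Type*} [MeasurableSpace Ω] (μ : Measure Ω)
    (C : Ω → CoinMatrix d) (r : Coin d → Lattice d) (v : Fin d → ℝ) (z : ℂ) : PairMatrix d :=
  (meanTransfer μ C r (-v) v - z • (1 : PairMatrix d))⁻¹ - (1 - z)⁻¹ • projPsi d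

/-- `S_v(1)`, the value at `z = 1` of the continuous extension of `S_v`. -/
def reducedResolventOne {d : ℕ} {Ω : Type*} [MeasurableSpace Ω] (μ : Measure Ω)
    (C : Ω → CoinMatrix d) (r : Coin d → Lattice d) (v : Fin d → ℝ) : PairMatrix d :=
  limUnder (𝓝[≠] (1 : ℂ)) (reducedResolvent μ C r v)

/-- The mean jump `r̄ = (1/2d) ∑_τ r(τ)`. -/
def meanJump {d : ℕ} (r : Coin d → Lattice d) (j : Fin d) : ℝ :=
  (2 * d : ℝ)⁻¹ * ∑ τ : Coin d, (r τ j : ℝ)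

/-- `y r̄ = ∑_j y_j r̄_j`. -/
def drift {d : ℕ} (r : Coin d → Lattice d) (y : Fin d → ℝ) : ℝ := ∑ j, y j * meanJump r j

/-- The symmetric matrix `A(v)` of the second order term `-½ ⟨y, A(v) y⟩` in the expansion at
`y = 0` of the eigenvalue of `ℳ(y-v,v)` close to `1`:
`-½ ⟨y, A(v) y⟩ = (1/2d) (∑_τ (y r(τ))²/2`
`  + ∑_{τ,τ'} (y r(τ)) (y r(τ')) {⟨τ⊗τ| S_v(1) |τ'⊗τ'⟩ - 1/(2d)})`. -/
def secondOrderMatrix {d : ℕ} {Ω : Type*} [MeasurableSpace Ω] (μ : Measure Ω)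
    (C : Ω → CoinMatrix d) (r : Coin d → Lattice d) (v : Fin d → ℝ) : Matrix (Fin d) (Fin d) ℂ :=
  Matrix.of fun j k =>
    -(d : ℂ)⁻¹ * ((∑ τ : Coin d, (r τ j : ℂ) * (r τ k : ℂ) / 2) +
      ∑ τ : Coin d, ∑ τ' : Coin d,
        ((r τ j : ℂ) * (r τ' k : ℂ) + (r τ k : ℂ) * (r τ' j : ℂ)) / 2 *
          (reducedResolventOne μ C r v (τ, τ) (τ', τ') - (2 * d : ℂ)⁻¹))

/-- The diffusion matrix `𝔻(v)`, i.e. `𝔻(v) = A(v) - |r̄⟩⟨r̄|`. The last term comes from the centring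
factor `e^{-i[tn] r̄ y/√n}`: minus one half of `⟨y, 𝔻(v) y⟩` is the second order term of the logarithm
of the eigenvalue `1 + i y r̄ - ½ ⟨y, A(v) y⟩ + O(‖y‖³)`. -/
def diffusionMatrix {d : ℕ} {Ω : Type*} [MeasurableSpace Ω] (μ : Measure Ω)
    (C : Ω → CoinMatrix d) (r : Coin d → Lattice d) (v : Fin d → ℝ) : Matrix (Fin d) (Fin d) ℂ :=
  secondOrderMatrix μ C r v - Matrix.of fun j k => ((meanJump r j * meanJump r k : ℝ) : ℂ)

/-- The quadratic form `⟨y, 𝔻(v) y⟩`. -/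
def diffusionForm {d : ℕ} {Ω : Type*} [MeasurableSpace Ω] (μ : Measure Ω)
    (C : Ω → CoinMatrix d) (r : Coin d → Lattice d) (v y : Fin d → ℝ) : ℂ :=
  (fun j => (y j : ℂ)) ⬝ᵥ (diffusionMatrix μ C r v *ᵥ fun j => (y j : ℂ))

/-! ### The Fourier transform of the initial density matrix -/

/-- `R₀(y,y') = ∑_{k,k'} e^{i(yk + y'k')} ρ₀(k,k') ∈ M_{2d}(ℂ)`. -/
def fourierKernel {d : ℕ} (ρ₀ : WalkSpace d →L[ℂ] WalkSpace d) (y y' : Fin d → ℝ) :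
    CoinMatrix d :=
  ∑' p : Lattice d × Lattice d, (phase y p.1 * phase y' p.2) • kernel ρ₀ p.1 p.2

/-- The vector `𝐑₀(y,y') = ∑_{τ,τ'} ⟨τ|R₀(y,y') τ'⟩ |τ ⊗ τ'⟩`. -/
def fourierVec {d : ℕ} (ρ₀ : WalkSpace d →L[ℂ] WalkSpace d) (y y' : Fin d → ℝ) :
    Coin d × Coin d → ℂ :=
  fun T => fourierKernel ρ₀ y y' T.1 T.2

/-- The integral over `𝕋^d` with respect to the normalized measure `dṽ = dv / (2π)^d`. -/
def torusIntegral {d : ℕ} (f : (Fin d → ℝ) → ℂ) : ℂ :=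
  ((2 * Real.pi : ℝ) ^ d : ℂ)⁻¹ * ∫ v in torusBox d, f v

end

end QuantumWalk

namespace QuantumWalk

noncomputable section

/-! ### The one step recursion of the kernel -/

/-! One step maps each kernel entry to a finite combination of translated entries. The coins are
independent, so the averaged kernel obeys the same recursion with `meanCoin` as coefficients
(`averagedKernel_succ`). A Fourier transform in both positions turns translations into phases, hence
time `n` into `meanTransfer ^ n` applied to `fourierVec`. Tracing over the coin is pairing with
`Ψ₁`, and integrating over the relative momentum `v` selects the diagonal `x = y`. This writes
`Φ_n(y)` as the torus integral of `⟨Ψ₁| ℳ(y-v,v)^n 𝐑₀(y-v,v)⟩` (`charFn_eq_torusIntegral`).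

Unitarity makes `ℳ` a contraction, and `Ψ₁` is a left and right fixed vector of `ℳ(-v,v)`. Because
`⟨Ψ₁|` stands on the left, it suffices to control `P (E M)^N`, where `M = ℳ(-v,v)` and `E = 1 + i e
H - e² H²/2 + o(e²)` is the diagonal matrix of centred phases. Put `X = P + e A + e² B`, with `A`
and `B` chosen so that `X E M = exp(e² c) X + o(e²)`. Contractivity makes the errors of `N` steps
add up to at most `N · o(e²)`, so `P (E M)^N` tends to `exp(κ c) P` when `N e² → κ`
(`tendsto_mul_pow_of_perturbation`). No expansion of eigenvalues or eigenprojections is needed.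

The equations for `A` and `B` are solved with `S = S_v(1)`, an inverse of `M - 1` off the range of
`P`. It exists because the eigenvalue `1` is simple. Solvability at first order is `P H P = 0`,
which is the centring; at second order it fixes `c = -½ ⟨y, 𝔻(v) y⟩` (`diffusionForm_smul_projPsi`).

Dominated convergence, with a constant obtained from the summable kernel, passes to the integral.
The scale `e = n^{-1/2}` gives `κ = t`; `e = 1/n` gives `κ = 0`, leaving only the drift phase and
the trace of `ρ₀`. -/

theorem inner_ket {d : ℕ} (σ : Coin d) (x : Lattice d) (ψ : WalkSpace d) :
    inner ℂ (ket σ x) ψ = ψ x σ := by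
  rw [ket, lp.inner_single_left, EuclideanSpace.inner_single_left]
  simp

theorem tensorId_apply {d : ℕ} (A : CoinSpace d →L[ℂ] CoinSpace d) (ψ : WalkSpace d)
    (x : Lattice d) : tensorId A ψ x = A (ψ x) := rfl

theorem translation_apply {d : ℕ} (k : Lattice d) (ψ : WalkSpace d) (x : Lattice d) :
    translation k ψ x = ψ (x - k) := rfl

theorem coinOp_apply {d : ℕ} (A : CoinMatrix d) (u : CoinSpace d) (τ : Coin d) :
    coinOp A u τ = ∑ σ, A τ σ * u σ := by
  rw [coinOp, Matrix.ofLp_toEuclideanCLM]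
  rfl

theorem shift_apply {d : ℕ} (r : Coin d → Lattice d) (ψ : WalkSpace d) (x : Lattice d)
    (τ : Coin d) : shift r ψ x τ = ψ (x - r τ) τ := by
  have h : shift r ψ =
      ∑ σ : Coin d, tensorId (coinOp (Matrix.single σ σ 1)) (translation (r σ) ψ) := by
    simp [shift]
  rw [h, lp.coeFn_sum, Finset.sum_apply, WithLp.ofLp_sum, Finset.sum_apply]
  simp only [tensorId_apply, coinOp_apply, translation_apply]
  rw [Finset.sum_eq_single τ]
  · rw [Finset.sum_eq_single τ]
    · simp
    · intro b _ hb
      simp [hb.symm]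
    · simp
  · intro b _ hb
    simp [hb]
  · simp

/-- The one step operator `S (C ⊗ 𝕀)`. -/
def stepOp {d : ℕ} (r : Coin d → Lattice d) (A : CoinMatrix d) : WalkSpace d →L[ℂ] WalkSpace d :=
  shift r ∘L tensorId (coinOp A)

theorem stepOp_apply {d : ℕ} (r : Coin d → Lattice d) (A : CoinMatrix d) (ψ : WalkSpace d)
    (x : Lattice d) (τ : Coin d) :
    stepOp r A ψ x τ = ∑ σ, A τ σ * ψ (x - r τ) σ := by
  rw [stepOp, ContinuousLinearMap.comp_apply, shift_apply, tensorId_apply, coinOp_apply]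

/-- A kernel entry at time `n` pairs `ρ₀` with adjoint-evolved basis vectors. These remain finite
combinations of kets, so the recursion involves finite sums only. -/
theorem adjoint_stepOp_ket {d : ℕ} (r : Coin d → Lattice d) (A : CoinMatrix d)
    (τ : Coin d) (x : Lattice d) :
    (stepOp r A).adjoint (ket τ x) = ∑ σ, star (A τ σ) • ket σ (x - r τ) := by
  refine ext_inner_right ℂ fun ψ => ?_
  rw [ContinuousLinearMap.adjoint_inner_left, inner_ket, stepOp_apply, sum_inner]
  refine Finset.sum_congr rfl fun σ _ => ?_
  rw [inner_smul_left, inner_ket]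
  simp

theorem kernel_apply {d : ℕ} (ρ : WalkSpace d →L[ℂ] WalkSpace d) (x y : Lattice d)
    (σ τ : Coin d) : kernel ρ x y σ τ = inner ℂ (ket σ x) (ρ (ket τ y)) := rfl

theorem evolution_succ_apply {d : ℕ} (r : Coin d → Lattice d) (C : ℕ → CoinMatrix d) (n : ℕ)
    (ψ : WalkSpace d) :
    evolution r C (n + 1) ψ = stepOp r (C n) (evolution r C n ψ) := rfl

theorem evolution_zero_apply {d : ℕ} (r : Coin d → Lattice d) (C : ℕ → CoinMatrix d)
    (ψ : WalkSpace d) : evolution r C 0 ψ = ψ := rfl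

theorem adjoint_evolution_succ_ket {d : ℕ} (r : Coin d → Lattice d) (C : ℕ → CoinMatrix d)
    (n : ℕ) (τ : Coin d) (x : Lattice d) :
    (evolution r C (n + 1)).adjoint (ket τ x) =
      ∑ σ, star (C n τ σ) • (evolution r C n).adjoint (ket σ (x - r τ)) := by
  refine ext_inner_right ℂ fun φ => ?_
  rw [ContinuousLinearMap.adjoint_inner_left, evolution_succ_apply,
    ← ContinuousLinearMap.adjoint_inner_left, adjoint_stepOp_ket, sum_inner, sum_inner]
  refine Finset.sum_congr rfl fun σ _ => ?_
  rw [inner_smul_left, inner_smul_left, ContinuousLinearMap.adjoint_inner_left]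

theorem kernel_evolved {d : ℕ} (r : Coin d → Lattice d) (C : ℕ → CoinMatrix d)
    (ρ₀ : WalkSpace d →L[ℂ] WalkSpace d) (n : ℕ) (x y : Lattice d) (σ τ : Coin d) :
    kernel (evolved r C ρ₀ n) x y σ τ =
      inner ℂ ((evolution r C n).adjoint (ket σ x))
        (ρ₀ ((evolution r C n).adjoint (ket τ y))) := by
  rw [ContinuousLinearMap.adjoint_inner_left]
  rfl

theorem kernel_evolved_zero {d : ℕ} (r : Coin d → Lattice d) (C : ℕ → CoinMatrix d)
    (ρ₀ : WalkSpace d →L[ℂ] WalkSpace d) (x y : Lattice d) (σ τ : Coin d) :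
    kernel (evolved r C ρ₀ 0) x y σ τ = kernel ρ₀ x y σ τ := by
  have h : ∀ ψ, (evolution r C 0).adjoint ψ = ψ := fun ψ =>
    ext_inner_right ℂ fun φ => by
      rw [ContinuousLinearMap.adjoint_inner_left, evolution_zero_apply]
  rw [kernel_evolved, h, h, kernel_apply]

theorem kernel_evolved_succ {d : ℕ} (r : Coin d → Lattice d) (C : ℕ → CoinMatrix d)
    (ρ₀ : WalkSpace d →L[ℂ] WalkSpace d) (n : ℕ) (x y : Lattice d) (σ τ : Coin d) :
    kernel (evolved r C ρ₀ (n + 1)) x y σ τ =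
      ∑ T : Coin d × Coin d, (C n σ T.1 * star (C n τ T.2)) *
        kernel (evolved r C ρ₀ n) (x - r σ) (y - r τ) T.1 T.2 := by
  rw [kernel_evolved, adjoint_evolution_succ_ket, adjoint_evolution_succ_ket,
    map_sum, sum_inner]
  simp only [inner_sum]
  refine Eq.trans ?_ (Fintype.sum_prod_type _).symm
  refine Finset.sum_congr rfl fun σ' _ => ?_
  refine Finset.sum_congr rfl fun τ' _ => ?_
  rw [map_smul, inner_smul_left, inner_smul_right, kernel_evolved]
  simp [mul_assoc]

/-! ### Averaging over the coins -/

section Average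

variable {d : ℕ} {Ω : Type*} [mΩ : MeasurableSpace Ω]

/-- The kernel entry at time `n` depends measurably on the first `n` coins. -/
theorem measurable_kernel_evolved {C : Ω → CoinMatrix d}
    (hC : ∀ σ τ, Measurable fun ω => C ω σ τ) (r : Coin d → Lattice d)
    (ρ₀ : WalkSpace d →L[ℂ] WalkSpace d) (n : ℕ) (x y : Lattice d) (σ τ : Coin d) :
    Measurable[⨆ i ∈ Set.Iio n, mΩ.comap fun ω : ℕ → Ω => ω i]
      fun ω : ℕ → Ω => kernel (evolved r (fun k => C (ω k)) ρ₀ n) x y σ τ := by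
  induction n generalizing x y σ τ with
  | zero => simp only [kernel_evolved_zero]; exact measurable_const
  | succ n ih =>
    simp only [kernel_evolved_succ]
    have hle : (⨆ i ∈ Set.Iio n, mΩ.comap fun ω : ℕ → Ω => ω i) ≤
        ⨆ i ∈ Set.Iio (n + 1), mΩ.comap fun ω : ℕ → Ω => ω i :=
      biSup_mono fun i (hi : i < n) => Nat.lt_succ_of_lt hi
    have hn : mΩ.comap (fun ω : ℕ → Ω => ω n) ≤
        ⨆ i ∈ Set.Iio (n + 1), mΩ.comap fun ω : ℕ → Ω => ω i :=
      le_biSup (fun i => mΩ.comap fun ω : ℕ → Ω => ω i) (Nat.lt_succ_self n)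
    have he : ∀ σ τ, Measurable[⨆ i ∈ Set.Iio (n + 1), mΩ.comap fun ω : ℕ → Ω => ω i]
        fun ω : ℕ → Ω => C (ω n) σ τ := fun σ τ =>
      ((hC σ τ).comp (comap_measurable fun ω : ℕ → Ω => ω n)).mono hn le_rfl
    refine Finset.measurable_fun_sum _ fun T _ => ?_
    refine ((he _ _).mul ?_).mul ((ih _ _ _ _).mono hle le_rfl)
    exact Complex.continuous_conj.measurable.comp (he _ _)

theorem measurable_kernel_evolved' {C : Ω → CoinMatrix d}
    (hC : ∀ σ τ, Measurable fun ω => C ω σ τ) (r : Coin d → Lattice d)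
    (ρ₀ : WalkSpace d →L[ℂ] WalkSpace d) (n : ℕ) (x y : Lattice d) (σ τ : Coin d) :
    Measurable fun ω : ℕ → Ω => kernel (evolved r (fun k => C (ω k)) ρ₀ n) x y σ τ :=
  (measurable_kernel_evolved hC r ρ₀ n x y σ τ).mono
    (iSup₂_le fun i _ => (measurable_pi_apply i).comap_le) le_rfl

theorem norm_entry_le_one {A : CoinMatrix d} (hA : A ∈ Matrix.unitaryGroup (Coin d) ℂ)
    (σ τ : Coin d) : ‖A σ τ‖ ≤ 1 :=
  entry_norm_bound_of_unitary hA σ τ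

/-- The bound is crude and grows with `n`; it serves only to make each entry integrable over the
coins. -/
theorem norm_kernel_evolved_le {C : ℕ → CoinMatrix d}
    (hC : ∀ k, C k ∈ Matrix.unitaryGroup (Coin d) ℂ) (r : Coin d → Lattice d)
    (ρ₀ : WalkSpace d →L[ℂ] WalkSpace d) (n : ℕ) (x y : Lattice d) (σ τ : Coin d) :
    ‖kernel (evolved r C ρ₀ n) x y σ τ‖ ≤ (Fintype.card (Coin d × Coin d) : ℝ) ^ n * ‖ρ₀‖ := by
  have hket : ∀ (σ : Coin d) (x : Lattice d), ‖ket σ x‖ = 1 := fun σ x => by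
    rw [ket, lp.norm_single (by norm_num)]; simp
  induction n generalizing x y σ τ with
  | zero =>
    rw [kernel_evolved_zero, kernel_apply, pow_zero, one_mul]
    refine (norm_inner_le_norm _ _).trans ?_
    rw [hket, one_mul]
    simpa [hket] using ρ₀.le_opNorm (ket τ y)
  | succ n ih =>
    rw [kernel_evolved_succ]
    refine (norm_sum_le _ _).trans ?_
    refine (Finset.sum_le_sum fun T _ => ?_ :
      _ ≤ ∑ T : Coin d × Coin d, (Fintype.card (Coin d × Coin d) : ℝ) ^ n * ‖ρ₀‖).trans
        (le_of_eq ?_)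
    · rw [norm_mul, norm_mul, norm_star]
      have h1 := norm_entry_le_one (hC n) σ T.1
      have h2 := norm_entry_le_one (hC n) τ T.2
      have h3 := mul_le_one₀ h1 (norm_nonneg _) h2
      calc _ ≤ 1 * ‖kernel (evolved r C ρ₀ n) (x - r σ) (y - r τ) T.1 T.2‖ := by gcongr
        _ ≤ _ := by rw [one_mul]; exact ih _ _ _ _
    · rw [Finset.sum_const, Finset.card_univ, nsmul_eq_mul, pow_succ]
      ring

/-- The averaged kernel `𝔼 ρ_n(x, y)`. -/
def averagedKernel (μ : Measure Ω) (C : Ω → CoinMatrix d) (r : Coin d → Lattice d)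
    (ρ₀ : WalkSpace d →L[ℂ] WalkSpace d) (n : ℕ) (x y : Lattice d) (T : Coin d × Coin d) : ℂ :=
  ∫ ω : ℕ → Ω, kernel (evolved r (fun k => C (ω k)) ρ₀ n) x y T.1 T.2
    ∂(Measure.infinitePi fun _ : ℕ => μ)

variable (μ : Measure Ω) [IsProbabilityMeasure μ] {C : Ω → CoinMatrix d}

theorem integrable_kernel_evolved (hC : ∀ σ τ, Measurable fun ω => C ω σ τ)
    (hU : ∀ ω, C ω ∈ Matrix.unitaryGroup (Coin d) ℂ) (r : Coin d → Lattice d)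
    (ρ₀ : WalkSpace d →L[ℂ] WalkSpace d) (n : ℕ) (x y : Lattice d) (σ τ : Coin d) :
    Integrable (fun ω : ℕ → Ω => kernel (evolved r (fun k => C (ω k)) ρ₀ n) x y σ τ)
      (Measure.infinitePi fun _ : ℕ => μ) :=
  Integrable.of_bound (measurable_kernel_evolved' hC r ρ₀ n x y σ τ).aestronglyMeasurable _
    (ae_of_all _ fun ω => norm_kernel_evolved_le (fun k => hU (ω k)) r ρ₀ n x y σ τ)

theorem averagedKernel_zero (r : Coin d → Lattice d)
    (ρ₀ : WalkSpace d →L[ℂ] WalkSpace d) (x y : Lattice d) (T : Coin d × Coin d) :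
    averagedKernel μ C r ρ₀ 0 x y T = kernel ρ₀ x y T.1 T.2 := by
  simp [averagedKernel, kernel_evolved_zero]

theorem measurable_pairEntry (hC : ∀ σ τ, Measurable fun ω => C ω σ τ)
    (S T : Coin d × Coin d) : Measurable fun ω => C ω S.1 T.1 * star (C ω S.2 T.2) :=
  (hC _ _).mul (Complex.continuous_conj.measurable.comp (hC _ _))

/-- The coin used in the step from `n` to `n + 1` is independent of the kernel at time `n`, which
depends on the coins of index below `n`. The expectation of the product therefore factors. -/
theorem averagedKernel_succ (hC : ∀ σ τ, Measurable fun ω => C ω σ τ)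
    (hU : ∀ ω, C ω ∈ Matrix.unitaryGroup (Coin d) ℂ) (r : Coin d → Lattice d)
    (ρ₀ : WalkSpace d →L[ℂ] WalkSpace d) (n : ℕ) (x y : Lattice d) (S : Coin d × Coin d) :
    averagedKernel μ C r ρ₀ (n + 1) x y S =
      ∑ T, meanCoin μ C S T * averagedKernel μ C r ρ₀ n (x - r S.1) (y - r S.2) T := by
  have hindep : ProbabilityTheory.iIndep (fun i : ℕ => mΩ.comap fun ω : ℕ → Ω => ω i)
      (Measure.infinitePi fun _ : ℕ => μ) :=
    (ProbabilityTheory.iIndepFun_iff_iIndep _ _ _).1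
      (ProbabilityTheory.iIndepFun_infinitePi (P := fun _ : ℕ => μ) (X := fun _ ω => ω)
        fun _ => measurable_id)
  have hdisj : Disjoint (Set.Ici n) (Set.Iio n) :=
    Set.disjoint_left.2 fun i hi hi' => absurd (Set.mem_Iio.1 hi') (not_lt.2 hi)
  have hI := ProbabilityTheory.indep_iSup_of_disjoint
    (fun i => (measurable_pi_apply (X := fun _ : ℕ => Ω) i).comap_le) hindep hdisj
  have hn : mΩ.comap (fun ω : ℕ → Ω => ω n) ≤
      ⨆ i ∈ Set.Ici n, mΩ.comap fun ω : ℕ → Ω => ω i :=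
    le_biSup (fun i => mΩ.comap fun ω : ℕ → Ω => ω i) (le_refl n)
  have hstep : ∀ T : Coin d × Coin d,
      ∫ ω : ℕ → Ω, (C (ω n) S.1 T.1 * star (C (ω n) S.2 T.2)) *
          kernel (evolved r (fun k => C (ω k)) ρ₀ n) (x - r S.1) (y - r S.2) T.1 T.2
        ∂(Measure.infinitePi fun _ : ℕ => μ) =
      meanCoin μ C S T * averagedKernel μ C r ρ₀ n (x - r S.1) (y - r S.2) T := by
    intro T
    have hf : Measurable[mΩ.comap fun ω : ℕ → Ω => ω n]
        fun ω : ℕ → Ω => C (ω n) S.1 T.1 * star (C (ω n) S.2 T.2) :=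
      (measurable_pairEntry hC S T).comp (comap_measurable fun ω : ℕ → Ω => ω n)
    have hfg : ProbabilityTheory.IndepFun
        (fun ω : ℕ → Ω => C (ω n) S.1 T.1 * star (C (ω n) S.2 T.2))
        (fun ω : ℕ → Ω =>
          kernel (evolved r (fun k => C (ω k)) ρ₀ n) (x - r S.1) (y - r S.2) T.1 T.2)
        (Measure.infinitePi fun _ : ℕ => μ) := by
      rw [ProbabilityTheory.IndepFun_iff_Indep]
      exact ProbabilityTheory.indep_of_indep_of_le_left
        (ProbabilityTheory.indep_of_indep_of_le_right hI
          (measurable_kernel_evolved hC r ρ₀ n _ _ _ _).comap_le)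
        ((hf.mono hn le_rfl).comap_le)
    rw [hfg.integral_fun_mul_eq_mul_integral
      ((measurable_pairEntry hC S T).comp (measurable_pi_apply n)).aestronglyMeasurable
      (measurable_kernel_evolved' hC r ρ₀ n _ _ _ _).aestronglyMeasurable]
    congr 1
    -- The `n`-th marginal of the product measure is `μ`, so the expectation of the coin factor is
    -- the one in `meanCoin`.
    have hmap := Measure.infinitePi_map_eval (fun _ : ℕ => μ) n
    rw [meanCoin, Matrix.of_apply]
    conv_rhs => rw [← hmap]
    rw [integral_map (measurable_pi_apply n).aemeasurable]
    · rfl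
    · exact (measurable_pairEntry hC S T).aestronglyMeasurable
  rw [averagedKernel]
  simp only [kernel_evolved_succ]
  rw [integral_finsetSum]
  · exact Finset.sum_congr rfl fun T _ => hstep T
  · intro T _
    refine (integrable_kernel_evolved μ hC hU r ρ₀ n _ _ _ _).bdd_mul (c := 1)
      ((measurable_pairEntry hC S T).comp (measurable_pi_apply n)).aestronglyMeasurable
      (ae_of_all _ fun ω => ?_)
    rw [norm_mul, norm_star]
    exact mul_le_one₀ (norm_entry_le_one (hU _) _ _) (norm_nonneg _)
      (norm_entry_le_one (hU _) _ _)

theorem averagedProb_eq (hC : ∀ σ τ, Measurable fun ω => C ω σ τ)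
    (hU : ∀ ω, C ω ∈ Matrix.unitaryGroup (Coin d) ℂ) (r : Coin d → Lattice d)
    (ρ₀ : WalkSpace d →L[ℂ] WalkSpace d) (n : ℕ) (z : Lattice d) :
    averagedProb μ C r ρ₀ n z = ∑ τ, averagedKernel μ C r ρ₀ n z z (τ, τ) := by
  simp only [averagedProb, positionProb, Matrix.trace, Matrix.diag, averagedKernel]
  exact integral_finsetSum _ fun τ _ => integrable_kernel_evolved μ hC hU r ρ₀ n _ _ _ _

end Average

/-! ### Second order perturbation of powers in a normed algebra -/

section Perturbation

variable {𝔸 : Type*} [NormedRing 𝔸] [NormedAlgebra ℂ 𝔸]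

/-- If `X` is a left eigenvector of `T` up to an error of size `q`, it is one of `T ^ k` up to an
error growing linearly in `k`. -/
theorem norm_mul_pow_sub_smul_le {X T : 𝔸} {m : ℂ} {K q : ℝ} (hT : ‖T‖ ≤ 1) (hK : 1 ≤ K)
    (hm : ‖m‖ ≤ K) (hX : ‖X * T - m • X‖ ≤ q) (k : ℕ) :
    ‖X * T ^ k - m ^ k • X‖ ≤ k * (K ^ k * q) := by
  have hq : 0 ≤ q := (norm_nonneg _).trans hX
  induction k with
  | zero => simp
  | succ k ih =>
    have h : X * T ^ (k + 1) - m ^ (k + 1) • X =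
        (X * T ^ k - m ^ k • X) * T + m ^ k • (X * T - m • X) := by
      rw [pow_succ T, pow_succ m, sub_mul, smul_sub, smul_mul_assoc, smul_smul, mul_assoc]
      abel
    rw [h]
    calc _ ≤ ‖X * T ^ k - m ^ k • X‖ * ‖T‖ + ‖m‖ ^ k * ‖X * T - m • X‖ := by
          refine (norm_add_le _ _).trans (add_le_add (norm_mul_le _ _) ?_)
          rw [norm_smul, norm_pow]
      _ ≤ k * (K ^ k * q) * 1 + K ^ k * q := by gcongr
      _ = (k + 1) * (K ^ k * q) := by ring
      _ ≤ (k + 1) * (K ^ (k + 1) * q) := by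
          gcongr
          · exact Nat.le_succ k
      _ = _ := by push_cast; ring

variable {M P S H : 𝔸} {c : ℂ}

/-- These are the equations of orders `e` and `e²` in `X E M = (1 + c e²) X`. An equation `Z (M - 1)
= R` is solved by `Z = R S` as soon as `R P = 0`; for `A` this condition is `hPHP`, for `B` it is
`hc`. -/
theorem exists_approx_left_eigenvector (hMP : M * P = P)
    (hS : S * (M - 1) = 1 - P) (hPHP : P * H * P = 0)
    (hc : c • P = (1 / 2 : ℂ) • (P * H * H * P) + P * H * S * H * P) :
    ∃ A B : 𝔸, A * M = A - I • (P * H * M) ∧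
      B * M = B + c • P + (1 / 2 : ℂ) • (P * H * H * M) - I • (A * H * M) := by
  have h1 : P * H * (S + 1) * M = P * H * (S + 1) + P * H * M := by
    have : P * H * (S + 1) * (M - 1) = P * H * M := by
      rw [mul_assoc, add_mul, hS, one_mul, sub_add_sub_cancel', mul_sub, hPHP, sub_zero]
    rw [mul_sub, mul_one, sub_eq_iff_eq_add] at this
    rw [this, add_comm]
  -- The `+ 1` beside `S` appears because `H` stands to the left of `M`. It contributes `P H H P` at
  -- second order, which turns the `-1/2` of the exponential series into the `+1/2` of `hc`.
  refine ⟨-I • (P * H * (S + 1)), (c • P + (1 / 2 : ℂ) • (P * H * H * M) -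
    I • (-I • (P * H * (S + 1)) * H * M)) * S, ?_, ?_⟩
  · rw [smul_mul_assoc, h1]
    module
  · set R := c • P + (1 / 2 : ℂ) • (P * H * H * M) - I • (-I • (P * H * (S + 1)) * H * M) with hR
    have hRP : R * P = 0 := by
      have hPP : P * P = P := by
        have h := congrArg (· * P) hS
        simp only [sub_mul, one_mul, mul_assoc, hMP, sub_self, mul_zero] at h
        exact (sub_eq_zero.1 h.symm).symm
      simp only [hR, sub_mul, add_mul, smul_mul_assoc, smul_smul, mul_add, mul_one]
      simp only [mul_assoc, hMP, hPP] at hc ⊢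
      rw [hc, mul_neg, I_mul_I]
      module
    have : R * S * (M - 1) = R := by rw [mul_assoc, hS, mul_sub, mul_one, hRP, sub_zero]
    rw [mul_sub, mul_one, sub_eq_iff_eq_add] at this
    rw [this, hR]
    module

/-- `X n` is a left eigenvector of the contraction `E n * M` up to `o(e²)`, with approximate
eigenvalue `m n = exp(e² c)`. Over `N ~ κ / e²` steps the error still vanishes, while `m ^ N` tends
to `exp(κ c)`. -/
theorem tendsto_mul_pow_of_perturbation (hPM : P * M = P) (hMP : M * P = P)
    (hS : S * (M - 1) = 1 - P) (hPHP : P * H * P = 0)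
    (hc : c • P = (1 / 2 : ℂ) • (P * H * H * P) + P * H * S * H * P) (hM : ‖M‖ ≤ 1)
    {e : ℕ → ℝ} (he : Tendsto e atTop (𝓝 0)) {E Rem : ℕ → 𝔸} (hE : ∀ n, ‖E n‖ ≤ 1)
    (hRem : Tendsto Rem atTop (𝓝 0))
    (hexp : ∀ n, E n = 1 + (I * e n) • H - ((e n : ℂ) ^ 2 / 2) • (H * H) + (e n : ℂ) ^ 2 • Rem n)
    {N : ℕ → ℕ} {κ : ℝ} (hN : Tendsto (fun n => N n * e n ^ 2) atTop (𝓝 κ)) :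
    Tendsto (fun n => P * (E n * M) ^ N n) atTop (𝓝 (Complex.exp (κ * c) • P)) := by
  obtain ⟨A, B, hA, hB⟩ := exists_approx_left_eigenvector hMP hS hPHP hc
  have heC : Tendsto (fun n => (e n : ℂ)) atTop (𝓝 0) := by
    exact_mod_cast (Complex.continuous_ofReal.tendsto 0).comp he
  have he2 : Tendsto (fun n => (e n : ℂ) ^ 2) atTop (𝓝 0) := by simpa using heC.pow 2
  let X : ℕ → 𝔸 := fun n => P + (e n : ℂ) • A + (e n : ℂ) ^ 2 • B
  have hX : Tendsto X atTop (𝓝 P) := by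
    simpa [X] using ((tendsto_const_nhds (x := P)).add (heC.smul_const A)).add (he2.smul_const B)
  let m : ℕ → ℂ := fun n => Complex.exp ((e n : ℂ) ^ 2 * c)
  -- The remainder of `m n` divided by `e²`. Where `e n = 0` the quotient is `0`, and the expansion
  -- `hm` still holds.
  let ρ : ℕ → ℂ := fun n => (m n - 1 - (e n : ℂ) ^ 2 * c) / (e n : ℂ) ^ 2
  have hm : ∀ n, m n = 1 + (e n : ℂ) ^ 2 * c + (e n : ℂ) ^ 2 * ρ n := fun n => by
    rcases eq_or_ne (e n) 0 with h | h
    · simp [m, h]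
    · have : (e n : ℂ) ≠ 0 := by exact_mod_cast h
      simp only [ρ]
      field_simp
      ring
  have hρ : Tendsto ρ atTop (𝓝 0) := by
    have hsmall : ∀ᶠ n in atTop, ‖(e n : ℂ) ^ 2 * c‖ ≤ 1 := by
      have : Tendsto (fun n => ‖(e n : ℂ) ^ 2 * c‖) atTop (𝓝 0) := by
        simpa using (he2.mul_const c).norm
      exact this.eventually_le_const one_pos
    refine squeeze_zero_norm' (a := fun n => ‖(e n : ℂ) ^ 2‖ * ‖c‖ ^ 2) ?_ ?_
    · filter_upwards [hsmall] with n hn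
      have h := Complex.norm_exp_sub_one_sub_id_le hn
      simp only [ρ, m]
      rw [norm_div]
      refine div_le_of_le_mul₀ (norm_nonneg _) (by positivity) (h.trans (le_of_eq ?_))
      rw [norm_mul]
      ring
    · simpa using he2.norm.mul_const (‖c‖ ^ 2)
  -- What is left of `X E M - m X` after cancelling orders `0`, `1` and `2`, divided by `e²`.
  let Q : ℕ → 𝔸 := fun n =>
    (e n : ℂ) • (I • (B * H * M) - (1 / 2 : ℂ) • (A * H * H * M) - c • A) -
      (e n : ℂ) ^ 2 • ((1 / 2 : ℂ) • (B * H * H * M) + c • B) + X n * Rem n * M - ρ n • X n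
  have hQ : Tendsto Q atTop (𝓝 0) := by
    have h := (((heC.smul_const (I • (B * H * M) - (1 / 2 : ℂ) • (A * H * H * M) - c • A)).sub
      (he2.smul_const ((1 / 2 : ℂ) • (B * H * H * M) + c • B))).add
      ((hX.mul hRem).mul_const M)).sub (hρ.smul hX)
    simpa only [zero_smul, sub_zero, mul_zero, zero_mul, add_zero] using h
  have hkey : ∀ n, X n * (E n * M) - m n • X n = (e n : ℂ) ^ 2 • Q n := fun n => by
    have hXdef : X n = P + (e n : ℂ) • A + (e n : ℂ) ^ 2 • B := rfl
    have h1 : X n * (E n * M) = X n * M + (I * e n) • (X n * H * M) -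
        ((e n : ℂ) ^ 2 / 2) • (X n * H * H * M) + (e n : ℂ) ^ 2 • (X n * Rem n * M) := by
      rw [hexp n]
      simp only [add_mul, sub_mul, mul_add, mul_sub, smul_mul_assoc, mul_smul_comm, one_mul,
        mul_assoc]
    have h2 : X n * M = X n + (e n : ℂ) • (- I • (P * H * M)) + (e n : ℂ) ^ 2 •
        (c • P + (1 / 2 : ℂ) • (P * H * H * M) - I • (A * H * M)) := by
      rw [hXdef, add_mul, add_mul, smul_mul_assoc, smul_mul_assoc, hPM, hA, hB]
      module
    have h3 : X n * H * M = P * H * M + (e n : ℂ) • (A * H * M) + (e n : ℂ) ^ 2 • (B * H * M) := by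
      rw [hXdef]
      simp only [add_mul, smul_mul_assoc]
    have h4 : X n * H * H * M = P * H * H * M + (e n : ℂ) • (A * H * H * M) +
        (e n : ℂ) ^ 2 • (B * H * H * M) := by
      rw [hXdef]
      simp only [add_mul, smul_mul_assoc]
    have h5 : c • X n = c • P + (e n : ℂ) • (c • A) + (e n : ℂ) ^ 2 • (c • B) := by
      rw [hXdef]
      module
    have h6 : m n • X n = X n + (e n : ℂ) ^ 2 • (c • X n) + (e n : ℂ) ^ 2 • (ρ n • X n) := by
      rw [hm n]
      module
    rw [h1, h2, h3, h4, h6, h5]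
    simp only [Q]
    module
  have hEM : ∀ n, ‖E n * M‖ ≤ 1 := fun n =>
    (norm_mul_le _ _).trans (mul_le_one₀ (hE n) (norm_nonneg _) hM)
  -- With this choice `K ^ N = exp(N e² ‖c‖)` converges, so the accumulated error is controlled by
  -- `N e² ‖Q‖`.
  let K : ℕ → ℝ := fun n => Real.exp (e n ^ 2 * ‖c‖)
  have hK : ∀ n, 1 ≤ K n := fun n => Real.one_le_exp (by positivity)
  have hmK : ∀ n, ‖m n‖ ≤ K n := fun n => by
    refine (Complex.norm_exp_le_exp_norm _).trans (le_of_eq ?_)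
    simp [K]
  have hNC : Tendsto (fun n => (N n : ℂ) * (e n : ℂ) ^ 2) atTop (𝓝 κ) := by
    refine ((Complex.continuous_ofReal.tendsto κ).comp hN).congr fun n => ?_
    simp
  have hmain : Tendsto (fun n => X n * (E n * M) ^ N n - m n ^ N n • X n) atTop (𝓝 0) := by
    refine squeeze_zero_norm (a := fun n => Real.exp (N n * e n ^ 2 * ‖c‖) *
      (N n * e n ^ 2 * ‖Q n‖)) (fun n => ?_) ?_
    · refine (norm_mul_pow_sub_smul_le (hEM n) (hK n) (hmK n) (le_of_eq (by rw [hkey n]))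
        (N n)).trans (le_of_eq ?_)
      rw [norm_smul, ← Real.exp_nat_mul, norm_pow, Complex.norm_real, Real.norm_eq_abs, sq_abs,
        mul_assoc (N n : ℝ)]
      ring
    · simpa using ((Real.continuous_exp.tendsto _).comp (hN.mul_const ‖c‖)).mul
        (hN.mul hQ.norm)
  -- The maximum covers exponent `0`, since the norm of `1` is not assumed to be `1`.
  have hpow : ∀ n, ‖(E n * M) ^ N n‖ ≤ max 1 ‖(1 : 𝔸)‖ := fun n => by
    rcases Nat.eq_zero_or_pos (N n) with h | h
    · simp [h]
    · exact ((norm_pow_le' _ h).trans (pow_le_one₀ (norm_nonneg _) (hEM n))).trans (le_max_left _ _)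
  have hdiff : Tendsto (fun n => (X n - P) * (E n * M) ^ N n) atTop (𝓝 0) := by
    refine squeeze_zero_norm (a := fun n => ‖X n - P‖ * max 1 ‖(1 : 𝔸)‖) (fun n => ?_) ?_
    · exact (norm_mul_le _ _).trans (by gcongr; exact hpow n)
    · simpa using (hX.sub_const P).norm.mul_const (max 1 ‖(1 : 𝔸)‖)
  have hlead : Tendsto (fun n => m n ^ N n • X n) atTop (𝓝 (Complex.exp (κ * c) • P)) := by
    refine Tendsto.smul ?_ hX
    have h := (Complex.continuous_exp.tendsto _).comp (hNC.mul_const c)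
    refine h.congr fun n => ?_
    simp only [Function.comp, m]
    rw [← Complex.exp_nat_mul, mul_assoc]
  have := (hmain.add hlead).sub hdiff
  simp only [zero_add, sub_zero] at this
  refine this.congr fun n => ?_
  rw [sub_add_cancel, sub_mul, sub_sub_cancel]

end Perturbation

/-! ### Phases and orthogonality of characters -/

section Phase

variable {d : ℕ}

theorem phase_add_right (y : Fin d → ℝ) (k l : Lattice d) :
    phase y (k + l) = phase y k * phase y l := by
  simp only [phase, ← Complex.exp_add, Pi.add_apply]
  congr 1
  push_cast
  simp only [mul_add, Finset.sum_add_distrib]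

theorem phase_add_left (y y' : Fin d → ℝ) (k : Lattice d) :
    phase (y + y') k = phase y k * phase y' k := by
  simp only [phase, ← Complex.exp_add, Pi.add_apply]
  congr 1
  push_cast
  simp only [add_mul, mul_add, Finset.sum_add_distrib]

theorem phase_zero_left (k : Lattice d) : phase (0 : Fin d → ℝ) k = 1 := by
  simp [phase]

theorem norm_phase (y : Fin d → ℝ) (k : Lattice d) : ‖phase y k‖ = 1 := by
  rw [phase, mul_comm, Complex.norm_exp_ofReal_mul_I]

theorem phase_neg_mul (y : Fin d → ℝ) (k : Lattice d) : phase (-y) k * phase y k = 1 := by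
  rw [← phase_add_left, neg_add_cancel, phase_zero_left]

theorem continuous_phase (k : Lattice d) : Continuous fun y : Fin d → ℝ => phase y k := by
  unfold phase
  fun_prop

theorem phase_eq_prod (y : Fin d → ℝ) (k : Lattice d) :
    phase y k = ∏ j, Complex.exp (I * k j * y j) := by
  rw [phase, ← Complex.exp_sum]
  congr 1
  push_cast
  rw [Finset.mul_sum]
  exact Finset.sum_congr rfl fun j _ => by ring

theorem integral_exp_int_mul (k : ℤ) :
    ∫ x in Set.Ico 0 (2 * Real.pi), Complex.exp (I * k * x) =
      if k = 0 then ((2 * Real.pi : ℝ) : ℂ) else 0 := by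
  rw [integral_Ico_eq_integral_Ioc, ← intervalIntegral.integral_of_le (by positivity)]
  split_ifs with h
  · simp [h]
  · rw [integral_exp_mul_complex (mul_ne_zero I_ne_zero (by exact_mod_cast h))]
    have : Complex.exp (I * k * ((2 * Real.pi : ℝ) : ℂ)) = 1 := by
      rw [← Complex.exp_int_mul_two_pi_mul_I k]
      congr 1
      push_cast
      ring
    rw [this]
    simp

theorem volume_restrict_torusBox :
    (volume : Measure (Fin d → ℝ)).restrict (torusBox d) =
      Measure.pi fun _ => (volume : Measure ℝ).restrict (Set.Ico 0 (2 * Real.pi)) := by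
  rw [torusBox, volume_pi, Measure.restrict_pi_pi]

instance isFiniteMeasure_restrict_torusBox :
    IsFiniteMeasure ((volume : Measure (Fin d → ℝ)).restrict (torusBox d)) := by
  rw [volume_restrict_torusBox]
  infer_instance

theorem torusIntegral_phase (k : Lattice d) :
    torusIntegral (fun v => phase v k) = if k = 0 then 1 else 0 := by
  have hpi : ((2 * Real.pi : ℝ) : ℂ) ≠ 0 := by exact_mod_cast Real.two_pi_pos.ne'
  rw [torusIntegral, volume_restrict_torusBox]
  simp only [phase_eq_prod]
  rw [integral_fintype_prod_eq_prod (𝕜 := ℂ) (fun j (x : ℝ) => Complex.exp (I * k j * x))]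
  simp only [integral_exp_int_mul]
  split_ifs with h
  · subst h
    simp only [Pi.zero_apply, if_true, Finset.prod_const, Finset.card_univ, Fintype.card_fin]
    exact inv_mul_cancel₀ (pow_ne_zero _ hpi)
  · obtain ⟨j, hj⟩ := Function.ne_iff.1 h
    rw [Finset.prod_eq_zero (Finset.mem_univ j) (by simpa using hj), mul_zero]

/-- Integrating out the relative momentum restricts a summable kernel to its diagonal. -/
theorem torusIntegral_tsum_phase {f : Lattice d × Lattice d → ℂ} (hf : Summable fun p => ‖f p‖)
    (y : Fin d → ℝ) :
    torusIntegral (fun v => ∑' p, phase (y + -v) p.1 * phase v p.2 * f p) =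
      ∑' z, f (z, z) * phase y z := by
  have hphase : ∀ (v : Fin d → ℝ) (p : Lattice d × Lattice d),
      phase (y + -v) p.1 * phase v p.2 * f p = (f p * phase y p.1) * phase v (p.2 - p.1) := by
    intro v p
    have h : phase v p.2 = phase v (p.2 - p.1) * phase v p.1 := by
      rw [← phase_add_right, sub_add_cancel]
    rw [phase_add_left, h]
    linear_combination (phase y p.1 * phase v (p.2 - p.1) * f p) * phase_neg_mul v p.1
  have hint : ∀ p : Lattice d × Lattice d,
      IntegrableOn (fun v => (f p * phase y p.1) * phase v (p.2 - p.1)) (torusBox d) := fun p =>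
    Integrable.of_bound (continuous_const.mul (continuous_phase _)).aestronglyMeasurable ‖f p‖
      (ae_of_all _ fun v => by rw [norm_mul, norm_mul, norm_phase, norm_phase, mul_one, mul_one])
  have hsum : Summable fun p : Lattice d × Lattice d =>
      ∫ v in torusBox d, ‖(f p * phase y p.1) * phase v (p.2 - p.1)‖ := by
    simp only [norm_mul, norm_phase, mul_one, integral_const, smul_eq_mul]
    exact hf.mul_left _
  have hval : ∀ p : Lattice d × Lattice d,
      torusIntegral (fun v => (f p * phase y p.1) * phase v (p.2 - p.1)) =
        if p.2 = p.1 then f p * phase y p.1 else 0 := by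
    intro p
    have h : torusIntegral (fun v => (f p * phase y p.1) * phase v (p.2 - p.1)) =
        (f p * phase y p.1) * torusIntegral (fun v => phase v (p.2 - p.1)) := by
      simp only [torusIntegral, integral_const_mul]
      ring
    rw [h, torusIntegral_phase]
    simp [sub_eq_zero]
  simp only [hphase]
  rw [torusIntegral, ← integral_tsum_of_summable_integral_norm hint hsum, ← tsum_mul_left]
  -- Only the pairs with `p.2 = p.1` survive, so the sum over pairs is reindexed along the diagonal.
  have hdiag : Function.Injective fun z : Lattice d => (z, z) := fun a b h => (Prod.mk.inj h).1
  refine (tsum_congr hval).trans ?_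
  rw [← hdiag.tsum_eq]
  · simp
  · rintro ⟨a, b⟩ hab
    have : b = a := by
      by_contra h
      simp [h] at hab
    exact ⟨a, by rw [this]⟩

end Phase

/-! ### The Fourier transform of the averaged kernel -/

section Transform

variable {d : ℕ} {Ω : Type*} [MeasurableSpace Ω] (μ : Measure Ω) [IsProbabilityMeasure μ]
  {C : Ω → CoinMatrix d} (hC : ∀ σ τ, Measurable fun ω => C ω σ τ)
  (hU : ∀ ω, C ω ∈ Matrix.unitaryGroup (Coin d) ℂ) (r : Coin d → Lattice d)
  {ρ₀ : WalkSpace d →L[ℂ] WalkSpace d}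
  (hρ : ∀ σ τ, Summable fun p : Lattice d × Lattice d => ‖kernel ρ₀ p.1 p.2 σ τ‖)

/-- Translation of pairs of sites. -/
abbrev pairShift (r : Coin d → Lattice d) (S : Coin d × Coin d) :
    Lattice d × Lattice d ≃ Lattice d × Lattice d :=
  Equiv.addRight (r S.1, r S.2)

include hC hU hρ in
-- One step is a finite combination of translates, and translating both sites preserves summability
-- over pairs.
theorem summable_averagedKernel (n : ℕ) (T : Coin d × Coin d) :
    Summable fun p : Lattice d × Lattice d => averagedKernel μ C r ρ₀ n p.1 p.2 T := by
  induction n generalizing T with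
  | zero =>
    simp only [averagedKernel_zero]
    exact (hρ T.1 T.2).of_norm
  | succ n ih =>
    simp only [averagedKernel_succ μ hC hU]
    refine summable_sum fun S _ => Summable.mul_left _ ?_
    exact (pairShift r T).symm.summable_iff.2 (ih S)

/-- The Fourier transform of the averaged kernel at time `n`. -/
def averagedTransform (μ : Measure Ω) (C : Ω → CoinMatrix d) (r : Coin d → Lattice d)
    (ρ₀ : WalkSpace d →L[ℂ] WalkSpace d) (n : ℕ) (y y' : Fin d → ℝ) (T : Coin d × Coin d) : ℂ :=
  ∑' p : Lattice d × Lattice d, phase y p.1 * phase y' p.2 * averagedKernel μ C r ρ₀ n p.1 p.2 T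

theorem summable_phase_mul {f : Lattice d × Lattice d → ℂ} (hf : Summable f) (y y' : Fin d → ℝ) :
    Summable fun p => phase y p.1 * phase y' p.2 * f p :=
  Summable.of_norm (by simpa only [norm_mul, norm_phase, one_mul] using hf.norm)

include hC hU hρ in
-- Reindexing by the jump of the output label `S` extracts the phases `e^{iy r(S.1)} e^{iy'
-- r(S.2)}`, the diagonal entries of `D(y,y')`.
theorem averagedTransform_succ (n : ℕ) (y y' : Fin d → ℝ) :
    averagedTransform μ C r ρ₀ (n + 1) y y' =
      meanTransfer μ C r y y' *ᵥ averagedTransform μ C r ρ₀ n y y' := by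
  funext S
  have hsum := fun T => summable_phase_mul (summable_averagedKernel μ hC hU r hρ n T) y y'
  have hrhs : (meanTransfer μ C r y y' *ᵥ averagedTransform μ C r ρ₀ n y y') S =
      ∑ T, phase y (r S.1) * phase y' (r S.2) * meanCoin μ C S T *
        averagedTransform μ C r ρ₀ n y y' T := by
    simp only [Matrix.mulVec, dotProduct, meanTransfer, phaseMatrix, Matrix.diagonal_mul]
  rw [hrhs, averagedTransform, ← (pairShift r S).tsum_eq]
  simp only [averagedKernel_succ μ hC hU, averagedTransform, ← tsum_mul_left]
  rw [← Summable.tsum_finsetSum fun T _ => (hsum T).mul_left _]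
  refine tsum_congr fun p => ?_
  simp only [Equiv.coe_addRight, Prod.fst_add, Prod.snd_add, add_sub_cancel_right,
    phase_add_right, Finset.mul_sum]
  exact Finset.sum_congr rfl fun T _ => by ring

theorem summable_kernel_matrix (hρ : ∀ σ τ, Summable fun p : Lattice d × Lattice d =>
      ‖kernel ρ₀ p.1 p.2 σ τ‖) (y y' : Fin d → ℝ) :
    Summable fun p : Lattice d × Lattice d =>
      (phase y p.1 * phase y' p.2) • kernel ρ₀ p.1 p.2 := by
  refine Pi.summable.2 fun σ => Pi.summable.2 fun τ => ?_
  exact summable_phase_mul (hρ σ τ).of_norm y y'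

theorem fourierKernel_apply (hρ : ∀ σ τ, Summable fun p : Lattice d × Lattice d =>
      ‖kernel ρ₀ p.1 p.2 σ τ‖) (y y' : Fin d → ℝ) (σ τ : Coin d) :
    fourierKernel ρ₀ y y' σ τ = ∑' p : Lattice d × Lattice d,
      phase y p.1 * phase y' p.2 * kernel ρ₀ p.1 p.2 σ τ := by
  have h := (summable_kernel_matrix hρ y y').hasSum
  exact (Pi.hasSum.1 (Pi.hasSum.1 h σ) τ).tsum_eq.symm

include hC hU hρ in
theorem averagedTransform_eq (n : ℕ) (y y' : Fin d → ℝ) :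
    averagedTransform μ C r ρ₀ n y y' =
      (meanTransfer μ C r y y') ^ n *ᵥ fourierVec ρ₀ y y' := by
  induction n with
  | zero =>
    funext T
    rw [pow_zero, Matrix.one_mulVec, fourierVec, fourierKernel_apply hρ, averagedTransform]
    simp only [averagedKernel_zero]
  | succ n ih =>
    rw [averagedTransform_succ μ hC hU r hρ, ih, Matrix.mulVec_mulVec, pow_succ']

theorem psiOne_dotProduct (w : Coin d × Coin d → ℂ) :
    star (psiOne d) ⬝ᵥ w = ∑ τ, w (τ, τ) := by
  simp only [dotProduct, Pi.star_apply, psiOne]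
  rw [Fintype.sum_prod_type]
  refine Finset.sum_congr rfl fun σ _ => ?_
  rw [Finset.sum_eq_single σ]
  · simp
  · intro τ _ h
    simp [h.symm]
  · simp

include hC hU hρ in
/-- The momentum space representation of the averaged characteristic function. -/
theorem charFn_eq_torusIntegral (n : ℕ) (y : Fin d → ℝ) :
    charFn μ C r ρ₀ n y = torusIntegral fun v =>
      star (psiOne d) ⬝ᵥ ((meanTransfer μ C r (y + -v) v) ^ n *ᵥ fourierVec ρ₀ (y + -v) v) := by
  have hsum := summable_averagedKernel μ hC hU r hρ n
  simp only [← averagedTransform_eq μ hC hU r hρ, psiOne_dotProduct, averagedTransform]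
  have h : ∀ v : Fin d → ℝ, ∑ τ, ∑' p : Lattice d × Lattice d, phase (y + -v) p.1 * phase v p.2 *
      averagedKernel μ C r ρ₀ n p.1 p.2 (τ, τ) = ∑' p : Lattice d × Lattice d,
        phase (y + -v) p.1 * phase v p.2 * ∑ τ, averagedKernel μ C r ρ₀ n p.1 p.2 (τ, τ) := by
    intro v
    rw [← Summable.tsum_finsetSum fun τ _ => summable_phase_mul (hsum (τ, τ)) _ _]
    exact tsum_congr fun p => by rw [Finset.mul_sum]
  simp only [h]
  rw [torusIntegral_tsum_phase (summable_sum fun τ _ => hsum (τ, τ)).norm]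
  simp only [charFn, averagedProb_eq μ hC hU]

/-- Substitute `k' = k + l`; at opposite momenta the phases in `k` cancel. -/
theorem hasSum_fourierKernel (hρ : ∀ σ τ, Summable fun p : Lattice d × Lattice d =>
      ‖kernel ρ₀ p.1 p.2 σ τ‖) (v : Fin d → ℝ) :
    HasSum (fun p : Lattice d × Lattice d => phase v p.2 • kernel ρ₀ p.1 (p.1 + p.2))
      (fourierKernel ρ₀ (-v) v) := by
  have h := (Equiv.hasSum_iff (Equiv.prodShear (Equiv.refl (Lattice d)) Equiv.addLeft)).2
    (summable_kernel_matrix hρ (-v) v).hasSum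
  convert! h using 1
  funext p
  simp only [Function.comp, Equiv.prodShear_apply, Equiv.refl_apply, Equiv.coe_addLeft,
    phase_add_right, ← mul_assoc, phase_neg_mul, one_mul]

theorem norm_fourierVec_le (hρ : ∀ σ τ, Summable fun p : Lattice d × Lattice d =>
      ‖kernel ρ₀ p.1 p.2 σ τ‖) (y y' : Fin d → ℝ) (T : Coin d × Coin d) :
    ‖fourierVec ρ₀ y y' T‖ ≤ ∑' p : Lattice d × Lattice d, ‖kernel ρ₀ p.1 p.2 T.1 T.2‖ := by
  rw [fourierVec, fourierKernel_apply hρ]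
  refine (norm_tsum_le_tsum_norm ?_).trans (le_of_eq ?_) <;>
    simp only [norm_mul, norm_phase, one_mul]
  exact hρ _ _

theorem continuous_fourierVec {X : Type*} [TopologicalSpace X] {f g : X → Fin d → ℝ}
    (hf : Continuous f) (hg : Continuous g)
    (hρ : ∀ σ τ, Summable fun p : Lattice d × Lattice d => ‖kernel ρ₀ p.1 p.2 σ τ‖) :
    Continuous fun x => fourierVec ρ₀ (f x) (g x) := by
  refine continuous_pi fun T => ?_
  simp only [fourierVec, fourierKernel_apply hρ]
  refine continuous_tsum (fun p => ?_) (hρ T.1 T.2) fun p q => ?_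
  · exact (((continuous_phase p.1).comp hf).mul ((continuous_phase p.2).comp hg)).mul
      continuous_const
  · rw [norm_mul, norm_mul, norm_phase, norm_phase, one_mul, one_mul]

end Transform

/-! ### The averaged transfer matrix is a contraction fixing `Ψ₁` -/

section Contraction

open scoped Matrix.Norms.L2Operator

variable {ι : Type*} [Fintype ι] [DecidableEq ι]

theorem norm_entry_le_opNorm (A : Matrix ι ι ℂ) (i j : ι) : ‖A i j‖ ≤ ‖A‖ := by
  have h := A.l2_opNorm_mulVec (EuclideanSpace.single j (1 : ℂ))
  rw [PiLp.norm_single, norm_one, mul_one] at h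
  refine le_trans ?_ ((PiLp.norm_apply_le _ i).trans h)
  simp [Matrix.mulVec_single]

theorem opNorm_le_one_of_mem_unitary {A : Matrix ι ι ℂ} (hA : A ∈ unitary (Matrix ι ι ℂ)) :
    ‖A‖ ≤ 1 := by
  rcases subsingleton_or_nontrivial (Matrix ι ι ℂ) with h | h
  · rw [Subsingleton.elim A 0, norm_zero]
    exact zero_le_one
  · exact (CStarRing.norm_of_mem_unitary hA).le

theorem opNorm_diagonal_le_one {f : ι → ℂ} (hf : ∀ i, ‖f i‖ ≤ 1) :
    ‖(Matrix.diagonal f : Matrix ι ι ℂ)‖ ≤ 1 := by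
  rw [Matrix.l2_opNorm_diagonal]
  exact (pi_norm_le_iff_of_nonneg zero_le_one).2 hf

/-- The entrywise mean of random matrices of norm at most one has norm at most one. -/
theorem opNorm_integral_le_one {Ω : Type*} [MeasurableSpace Ω] {μ : Measure Ω}
    [IsProbabilityMeasure μ] {K : Ω → Matrix ι ι ℂ} (hK : ∀ i j, Measurable fun ω => K ω i j)
    (hK1 : ∀ ω, ‖K ω‖ ≤ 1) : ‖Matrix.of fun i j => ∫ ω, K ω i j ∂μ‖ ≤ 1 := by
  have hmeas : AEStronglyMeasurable K μ := by
    have h : K = fun ω => ∑ i, ∑ j, K ω i j • Matrix.single i j (1 : ℂ) := by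
      funext ω
      conv_lhs => rw [Matrix.matrix_eq_sum_single (K ω)]
      simp [Matrix.smul_single]
    rw [h]
    refine Finset.aestronglyMeasurable_fun_sum _ fun i _ =>
      Finset.aestronglyMeasurable_fun_sum _ fun j _ => ?_
    exact (hK i j).aestronglyMeasurable.smul_const _
  have hint : Integrable K μ := Integrable.of_bound hmeas 1 (ae_of_all _ hK1)
  have h : (Matrix.of fun i j => ∫ ω, K ω i j ∂μ) = ∫ ω, K ω ∂μ := by
    ext i j
    exact (LinearMap.toContinuousLinearMap (Matrix.entryLinearMap ℂ ℂ i j)).integral_comp_comm hint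
  rw [h]
  refine (norm_integral_le_of_norm_le_const (ae_of_all _ hK1)).trans ?_
  simp

variable {d : ℕ} {Ω : Type*} [MeasurableSpace Ω] (μ : Measure Ω) [IsProbabilityMeasure μ]
  {C : Ω → CoinMatrix d} (hC : ∀ σ τ, Measurable fun ω => C ω σ τ)
  (hU : ∀ ω, C ω ∈ Matrix.unitaryGroup (Coin d) ℂ) (r : Coin d → Lattice d)

include hC hU

/-- `C ⊗ C̄` is unitary, and a mean of unitaries is a contraction in operator norm. -/
theorem opNorm_meanCoin_le_one : ‖meanCoin μ C‖ ≤ 1 := by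
  refine opNorm_integral_le_one (fun S T => measurable_pairEntry hC S T) fun ω => ?_
  refine opNorm_le_one_of_mem_unitary (Matrix.kronecker_mem_unitary (hU ω) ?_)
  have h : (C ω).map star = (star (C ω))ᵀ := by
    ext i j
    simp [Matrix.star_apply]
  have hs : star (star (C ω))ᵀ = (C ω)ᵀ := by
    ext i j
    simp [Matrix.star_apply]
  have h1 := Unitary.mem_iff.1 (hU ω)
  rw [h, Unitary.mem_iff, hs, ← Matrix.transpose_mul, ← Matrix.transpose_mul, h1.1, h1.2,
    Matrix.transpose_one]
  exact ⟨rfl, rfl⟩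

theorem opNorm_meanTransfer_le_one (y y' : Fin d → ℝ) : ‖meanTransfer μ C r y y'‖ ≤ 1 := by
  refine (norm_mul_le _ _).trans (mul_le_one₀ ?_ (norm_nonneg _) (opNorm_meanCoin_le_one μ hC hU))
  exact opNorm_diagonal_le_one fun T => by rw [norm_mul, norm_phase, norm_phase, one_mul]

theorem norm_meanTransfer_pow_entry_le_one (y y' : Fin d → ℝ) (n : ℕ) (S T : Coin d × Coin d) :
    ‖(meanTransfer μ C r y y' ^ n) S T‖ ≤ 1 := by
  rcases Nat.eq_zero_or_pos n with h | h
  · rw [h, pow_zero, Matrix.one_apply]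
    split_ifs <;> simp
  · exact (norm_entry_le_opNorm _ _ _).trans ((norm_pow_le' _ h).trans
      (pow_le_one₀ (norm_nonneg _) (opNorm_meanTransfer_le_one μ hC hU r y y')))

theorem integrable_pairEntry (S T : Coin d × Coin d) :
    Integrable (fun ω => C ω S.1 T.1 * star (C ω S.2 T.2)) μ :=
  Integrable.of_bound (measurable_pairEntry hC S T).aestronglyMeasurable 1
    (ae_of_all _ fun ω => by
      rw [norm_mul, norm_star]
      exact mul_le_one₀ (norm_entry_le_one (hU _) _ _) (norm_nonneg _)
        (norm_entry_le_one (hU _) _ _))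

/-- This is the mean of `C C* = 1`, read entrywise; the left version below is the mean of `C* C =
1`. -/
theorem meanCoin_mulVec_psiOne : meanCoin μ C *ᵥ psiOne d = psiOne d := by
  funext S
  have h : (meanCoin μ C *ᵥ psiOne d) S = ∑ τ, meanCoin μ C S (τ, τ) := by
    rw [← psiOne_dotProduct, dotProduct_comm, Matrix.mulVec]
    congr 1
    funext T
    simp only [psiOne, Pi.star_apply]
    split_ifs <;> simp
  have h2 : ∀ ω, ∑ τ, C ω S.1 τ * star (C ω S.2 τ) = psiOne d S := fun ω => by
    have h3 := congrFun (congrFun (Matrix.mem_unitaryGroup_iff.1 (hU ω)) S.1) S.2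
    rw [Matrix.mul_apply, Matrix.one_apply] at h3
    exact h3
  rw [h]
  simp only [meanCoin, Matrix.of_apply, Matrix.kroneckerMap_apply, Matrix.map_apply]
  rw [← integral_finsetSum _ fun τ _ => integrable_pairEntry μ hC hU S (τ, τ)]
  simp only [h2]
  simp

theorem psiOne_vecMul_meanCoin : star (psiOne d) ᵥ* meanCoin μ C = star (psiOne d) := by
  funext T
  have h : (star (psiOne d) ᵥ* meanCoin μ C) T = ∑ τ, meanCoin μ C (τ, τ) T := by
    rw [Matrix.vecMul, psiOne_dotProduct]
  have h2 : ∀ ω, ∑ τ, C ω τ T.1 * star (C ω τ T.2) = star (psiOne d) T := fun ω => by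
    have h3 := congrFun (congrFun (Matrix.mem_unitaryGroup_iff'.1 (hU ω)) T.2) T.1
    rw [Matrix.mul_apply, Matrix.one_apply] at h3
    simp only [Matrix.star_apply] at h3
    simp only [mul_comm (C ω _ T.1), h3, psiOne, Pi.star_apply, eq_comm (a := T.1)]
    split_ifs <;> simp
  rw [h]
  simp only [meanCoin, Matrix.of_apply, Matrix.kroneckerMap_apply, Matrix.map_apply]
  rw [← integral_finsetSum _ fun τ _ => integrable_pairEntry μ hC hU (τ, τ) T]
  simp only [h2]
  simp

/-- `D(-v,v)` acts trivially on the vectors `τ ⊗ τ`, where the two phases cancel. -/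
theorem meanTransfer_mulVec_psiOne (v : Fin d → ℝ) :
    meanTransfer μ C r (-v) v *ᵥ psiOne d = psiOne d := by
  rw [meanTransfer, ← Matrix.mulVec_mulVec, meanCoin_mulVec_psiOne μ hC hU, phaseMatrix]
  funext T
  rw [Matrix.mulVec_diagonal, psiOne]
  split_ifs with h
  · rw [h, phase_neg_mul, one_mul]
  · rw [mul_zero]

theorem psiOne_vecMul_meanTransfer (v : Fin d → ℝ) :
    star (psiOne d) ᵥ* meanTransfer μ C r (-v) v = star (psiOne d) := by
  have h : star (psiOne d) ᵥ* phaseMatrix r (-v) v = star (psiOne d) := by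
    funext T
    rw [phaseMatrix, Matrix.vecMul_diagonal, Pi.star_apply, psiOne]
    split_ifs with h
    · rw [h, phase_neg_mul, mul_one]
    · rw [star_zero, zero_mul]
  rw [meanTransfer, ← Matrix.vecMul_vecMul, h, psiOne_vecMul_meanCoin μ hC hU]

theorem meanTransfer_mul_projPsi (v : Fin d → ℝ) :
    meanTransfer μ C r (-v) v * projPsi d = projPsi d := by
  rw [projPsi, mul_smul_comm, Matrix.mul_vecMulVec, meanTransfer_mulVec_psiOne μ hC hU]

theorem projPsi_mul_meanTransfer (v : Fin d → ℝ) :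
    projPsi d * meanTransfer μ C r (-v) v = projPsi d := by
  rw [projPsi, smul_mul_assoc, Matrix.vecMulVec_mul, psiOne_vecMul_meanTransfer μ hC hU]

end Contraction

/-! ### The rank one projection onto `Ψ₁` -/

section Projection

variable {d : ℕ}

/-- Compression by a rank one projection yields a scalar. This is the source of the double sums over
`⟨τ⊗τ| · |τ'⊗τ'⟩` in the diffusion matrix. -/
theorem projPsi_mul_mul_projPsi (X : PairMatrix d) :
    projPsi d * X * projPsi d =
      ((2 * d : ℂ)⁻¹ * ∑ σ, ∑ τ, X (σ, σ) (τ, τ)) • projPsi d := by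
  have h : star (psiOne d) ᵥ* X ⬝ᵥ psiOne d = ∑ σ, ∑ τ, X (σ, σ) (τ, τ) := by
    rw [← Matrix.dotProduct_mulVec, psiOne_dotProduct]
    refine Finset.sum_congr rfl fun σ _ => ?_
    rw [← psiOne_dotProduct, dotProduct_comm, Matrix.mulVec]
    congr 1
    funext T
    simp only [psiOne, Pi.star_apply]
    split_ifs <;> simp
  rw [projPsi, smul_mul_assoc, smul_mul_assoc, mul_smul_comm, Matrix.vecMulVec_mul,
    Matrix.vecMulVec_mul_vecMulVec, h]
  simp only [smul_smul, Matrix.vecMulVec_smul]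
  ring_nf

theorem projPsi_mul_self (hd : d ≠ 0) : projPsi d * projPsi d = projPsi d := by
  have h := projPsi_mul_mul_projPsi (d := d) 1
  rw [mul_one] at h
  have hd' : (d : ℂ) ≠ 0 := by exact_mod_cast hd
  have hcard : ∑ σ : Coin d, ∑ τ : Coin d, (1 : PairMatrix d) (σ, σ) (τ, τ) = 2 * d := by
    simp [Matrix.one_apply, Finset.sum_ite_eq, mul_comm]
  rw [h, hcard, inv_mul_cancel₀ (mul_ne_zero two_ne_zero hd'), one_smul]

theorem psiOne_dotProduct_self : star (psiOne d) ⬝ᵥ psiOne d = 2 * d := by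
  rw [psiOne_dotProduct]
  simp [psiOne, mul_comm]

theorem psiOne_vecMul_projPsi (hd : d ≠ 0) : star (psiOne d) ᵥ* projPsi d = star (psiOne d) := by
  have hd' : (d : ℂ) ≠ 0 := by exact_mod_cast hd
  rw [projPsi, Matrix.vecMul_smul, Matrix.vecMul_vecMulVec, psiOne_dotProduct_self, smul_smul,
    inv_mul_cancel₀ (mul_ne_zero two_ne_zero hd'), one_smul]

theorem projPsi_mulVec_psiOne (hd : d ≠ 0) : projPsi d *ᵥ psiOne d = psiOne d := by
  have hd' : (d : ℂ) ≠ 0 := by exact_mod_cast hd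
  rw [projPsi, Matrix.smul_mulVec, Matrix.vecMulVec_mulVec, psiOne_dotProduct_self]
  rw [op_smul_eq_smul, smul_smul, inv_mul_cancel₀ (mul_ne_zero two_ne_zero hd'), one_smul]

end Projection

/-! ### The reduced resolvent -/

section Resolvent

variable {d : ℕ}

/-- Subtracting `P` moves the eigenvalue `1` away. If `(M - P) x = x`, applying `P` gives `P x = 0`,
hence `M x = x`; simplicity makes `x` a multiple of `Ψ₁`, and `P Ψ₁ = Ψ₁` forces `x = 0`. -/
theorem det_sub_projPsi_sub_one_ne_zero (hd : d ≠ 0) {M : PairMatrix d}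
    (hM : M *ᵥ psiOne d = psiOne d) (hPM : projPsi d * M = projPsi d)
    (hsimple : M.charpoly.rootMultiplicity 1 = 1) : (M - projPsi d - 1).det ≠ 0 := by
  intro hdet
  obtain ⟨x, hx0, hx⟩ := Matrix.exists_mulVec_eq_zero_iff.2 hdet
  rw [Matrix.sub_mulVec, Matrix.sub_mulVec, Matrix.one_mulVec] at hx
  have hPx : projPsi d *ᵥ x = 0 := by
    have h := congrArg (projPsi d *ᵥ ·) hx
    simp only [Matrix.mulVec_sub, Matrix.mulVec_mulVec, hPM, projPsi_mul_self hd,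
      Matrix.mulVec_zero] at h
    simpa using h
  have hMx : M *ᵥ x = x := by
    rw [hPx, sub_zero] at hx
    exact sub_eq_zero.1 hx
  have hfin : Module.finrank ℂ (Module.End.eigenspace M.toLin' 1) ≤ 1 := by
    refine (LinearMap.finrank_eigenspace_le _ _).trans (le_of_eq ?_)
    rw [Matrix.charpoly_toLin', hsimple]
  obtain ⟨u, hu⟩ := finrank_le_one_iff.1 hfin
  have hmem : ∀ w, M *ᵥ w = w → w ∈ Module.End.eigenspace M.toLin' 1 := fun w hw => by
    rw [Module.End.mem_eigenspace_iff, Matrix.toLin'_apply, hw, one_smul]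
  obtain ⟨a, ha⟩ := hu ⟨psiOne d, hmem _ hM⟩
  obtain ⟨b, hb⟩ := hu ⟨x, hmem _ hMx⟩
  have ha' : a • (u : Coin d × Coin d → ℂ) = psiOne d := congrArg Subtype.val ha
  have hb' : b • (u : Coin d × Coin d → ℂ) = x := congrArg Subtype.val hb
  have hPu : a • (projPsi d *ᵥ (u : Coin d × Coin d → ℂ)) = psiOne d := by
    rw [← Matrix.mulVec_smul, ha', projPsi_mulVec_psiOne hd]
  have hPu0 : b • (projPsi d *ᵥ (u : Coin d × Coin d → ℂ)) = 0 := by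
    rw [← Matrix.mulVec_smul, hb', hPx]
  have hb0 : b ≠ 0 := fun h => hx0 (by rw [← hb', h, zero_smul])
  have hpsi : psiOne d = 0 := by
    rw [← hPu, (smul_eq_zero.1 hPu0).resolve_left hb0, smul_zero]
  have h2 := psiOne_dotProduct_self (d := d)
  rw [hpsi] at h2
  simp only [star_zero, dotProduct_zero] at h2
  exact mul_ne_zero two_ne_zero (by exact_mod_cast hd) h2.symm

/-- `M - z` acts as `1 - z` on the range of `P` and as `M - P - z` on the complement. The pole at
`1` sits in the first block, so removing it leaves an expression regular at `z = 1`. -/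
theorem inv_sub_smul_eq {ι : Type*} [Fintype ι] [DecidableEq ι] {M P : Matrix ι ι ℂ}
    (hPP : P * P = P) (hMP : M * P = P) (hPM : P * M = P) {z : ℂ} (hz : z ≠ 1)
    (hdet : (M - P - z • (1 : Matrix ι ι ℂ)).det ≠ 0) :
    (M - z • (1 : Matrix ι ι ℂ))⁻¹ - (1 - z)⁻¹ • P =
      (M - P - z • (1 : Matrix ι ι ℂ))⁻¹ * (1 - P) := by
  set B := M - P - z • (1 : Matrix ι ι ℂ) with hB
  have hunit : IsUnit B.det := hdet.isUnit
  have hBP : B * P = P * B := by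
    rw [hB]
    simp only [sub_mul, mul_sub, hPP, hMP, hPM, smul_mul_assoc, mul_smul_comm, one_mul, mul_one]
  have hinv : B⁻¹ * P = P * B⁻¹ := by
    calc B⁻¹ * P = B⁻¹ * P * (B * B⁻¹) := by rw [Matrix.mul_nonsing_inv _ hunit, mul_one]
      _ = B⁻¹ * (B * P) * B⁻¹ := by rw [hBP]; simp only [mul_assoc]
      _ = P * B⁻¹ := by rw [← mul_assoc B⁻¹, Matrix.nonsing_inv_mul _ hunit, one_mul]
  have hz' : (1 - z) ≠ 0 := sub_ne_zero.2 hz.symm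
  have h : (M - z • (1 : Matrix ι ι ℂ)) * ((1 - z)⁻¹ • P + B⁻¹ * (1 - P)) = 1 := by
    have h1 : (M - z • (1 : Matrix ι ι ℂ)) * ((1 - z)⁻¹ • P) = P := by
      rw [mul_smul_comm, sub_mul, hMP, smul_mul_assoc, one_mul, ← one_smul ℂ P, smul_smul,
        mul_one, ← sub_smul, smul_smul, inv_mul_cancel₀ hz']
    have h2 : M - z • (1 : Matrix ι ι ℂ) = B + P := by rw [hB]; abel
    have h3 : (M - z • (1 : Matrix ι ι ℂ)) * (B⁻¹ * (1 - P)) = 1 - P := by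
      rw [h2, add_mul, ← mul_assoc, Matrix.mul_nonsing_inv _ hunit, one_mul, ← mul_assoc, ← hinv,
        mul_assoc, mul_sub, mul_one, hPP, sub_self, mul_zero, add_zero]
    rw [mul_add, h1, h3, add_sub_cancel]
  rw [Matrix.inv_eq_right_inv h, add_sub_cancel_left]

theorem tendsto_inv_sub_smul {ι : Type*} [Fintype ι] [DecidableEq ι] {M P : Matrix ι ι ℂ}
    (hPP : P * P = P) (hMP : M * P = P) (hPM : P * M = P) (hdet : (M - P - 1).det ≠ 0) :
    Tendsto (fun z : ℂ => (M - z • (1 : Matrix ι ι ℂ))⁻¹ - (1 - z)⁻¹ • P) (𝓝[≠] 1)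
      (𝓝 ((M - P - 1)⁻¹ * (1 - P))) := by
  have hB : Continuous fun z : ℂ => M - P - z • (1 : Matrix ι ι ℂ) := by fun_prop
  have hB1 : M - P - (1 : ℂ) • (1 : Matrix ι ι ℂ) = M - P - 1 := by rw [one_smul]
  have hev : ∀ᶠ z in 𝓝[≠] (1 : ℂ), (M - P - z • (1 : Matrix ι ι ℂ)).det ≠ 0 := by
    refine Filter.Eventually.filter_mono nhdsWithin_le_nhds ?_
    refine hB.matrix_det.continuousAt.eventually_ne ?_
    rwa [hB1]
  have hlim : Tendsto (fun z : ℂ => (M - P - z • (1 : Matrix ι ι ℂ))⁻¹ * (1 - P)) (𝓝[≠] 1)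
      (𝓝 ((M - P - 1)⁻¹ * (1 - P))) := by
    have hinv : ContinuousAt Inv.inv (M - P - 1) := by
      refine continuousAt_matrix_inv _ ?_
      rw [Ring.inverse_eq_inv']
      exact continuousAt_inv₀ hdet
    have h1 : Tendsto (fun z : ℂ => M - P - z • (1 : Matrix ι ι ℂ)) (𝓝[≠] 1) (𝓝 (M - P - 1)) := by
      have := hB.tendsto 1
      rw [hB1] at this
      exact this.mono_left nhdsWithin_le_nhds
    exact (hinv.tendsto.comp h1).mul tendsto_const_nhds
  refine hlim.congr' ?_
  filter_upwards [hev, self_mem_nhdsWithin] with z hz hz1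
  exact (inv_sub_smul_eq hPP hMP hPM hz1 hz).symm

/-- With `B = M - P - 1` one has `(1 - P)(M - 1) = B + P`, while `B⁻¹` acts as `-1` on the range of
`P`. -/
theorem reduced_inverse_relations {ι : Type*} [Fintype ι] [DecidableEq ι] {M P : Matrix ι ι ℂ}
    (hPP : P * P = P) (hMP : M * P = P) (hPM : P * M = P) (hdet : (M - P - 1).det ≠ 0) :
    (M - P - 1)⁻¹ * (1 - P) * (M - 1) = 1 - P ∧ (M - P - 1)⁻¹ * (1 - P) * P = 0 ∧
      P * ((M - P - 1)⁻¹ * (1 - P)) = 0 := by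
  set B := M - P - 1 with hB
  have hunit : IsUnit B.det := hdet.isUnit
  have hBP : B⁻¹ * P = -P := by
    have h : B * P = -P := by rw [hB, sub_mul, sub_mul, hMP, hPP, one_mul, sub_self, zero_sub]
    have h' := congrArg (B⁻¹ * ·) h
    simp only [← mul_assoc, Matrix.nonsing_inv_mul _ hunit, one_mul, mul_neg] at h'
    rw [eq_neg_iff_add_eq_zero, add_comm, ← eq_neg_iff_add_eq_zero]
    exact h'
  have hPB : P * B⁻¹ = -P := by
    have h : P * B = -P := by rw [hB, mul_sub, mul_sub, hPM, hPP, mul_one, sub_self, zero_sub]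
    have h' := congrArg (· * B⁻¹) h
    simp only [mul_assoc, Matrix.mul_nonsing_inv _ hunit, mul_one, neg_mul] at h'
    rw [eq_neg_iff_add_eq_zero, add_comm, ← eq_neg_iff_add_eq_zero]
    exact h'
  refine ⟨?_, ?_, ?_⟩
  · have h1 : (1 - P) * (M - 1) = B + P := by
      rw [sub_mul, mul_sub P, hPM, mul_one, sub_self, sub_zero, one_mul, hB]
      abel
    rw [mul_assoc, h1, mul_add, Matrix.nonsing_inv_mul _ hunit, hBP, sub_eq_add_neg]
  · rw [mul_assoc, sub_mul, hPP, one_mul, sub_self, mul_zero]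
  · rw [← mul_assoc, hPB, mul_sub, mul_one, neg_mul, hPP, sub_self]

theorem phase_toIcoMod (v : Fin d → ℝ) (k : Lattice d) :
    phase (fun j => toIcoMod Real.two_pi_pos 0 (v j)) k = phase v k := by
  rw [phase_eq_prod, phase_eq_prod]
  refine Finset.prod_congr rfl fun j _ => ?_
  rw [Complex.exp_eq_exp_iff_exists_int]
  refine ⟨-(k j * toIcoDiv Real.two_pi_pos 0 (v j)), ?_⟩
  rw [toIcoMod]
  simp only [zsmul_eq_mul]
  push_cast
  ring

theorem phase_neg_left (v : Fin d → ℝ) (k : Lattice d) : phase (-v) k = (phase v k)⁻¹ :=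
  eq_inv_of_mul_eq_one_left (phase_neg_mul v k)

variable {Ω : Type*} [MeasurableSpace Ω] (μ : Measure Ω)
  {C : Ω → CoinMatrix d} {r : Coin d → Lattice d} (hS : AssumptionS μ C r)

include hS in
/-- The eigenvalue `1` is simple at every momentum, by periodicity. -/
theorem rootMultiplicity_meanTransfer (v : Fin d → ℝ) :
    (meanTransfer μ C r (-v) v).charpoly.rootMultiplicity 1 = 1 := by
  have h : meanTransfer μ C r (-v) v = meanTransfer μ C r
      (-fun j => toIcoMod Real.two_pi_pos 0 (v j)) fun j => toIcoMod Real.two_pi_pos 0 (v j) := by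
    simp only [meanTransfer, phaseMatrix, phase_neg_left, phase_toIcoMod]
  rw [h]
  refine (hS _ fun j _ => ?_).2
  simpa using toIcoMod_mem_Ico Real.two_pi_pos 0 (v j)

variable [IsProbabilityMeasure μ] (hC : ∀ σ τ, Measurable fun ω => C ω σ τ)
  (hU : ∀ ω, C ω ∈ Matrix.unitaryGroup (Coin d) ℂ)

include hS hC hU

theorem det_meanTransfer_ne_zero (hd : d ≠ 0) (v : Fin d → ℝ) :
    (meanTransfer μ C r (-v) v - projPsi d - 1).det ≠ 0 :=
  det_sub_projPsi_sub_one_ne_zero hd (meanTransfer_mulVec_psiOne μ hC hU r v)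
    (projPsi_mul_meanTransfer μ hC hU r v) (rootMultiplicity_meanTransfer μ hS v)

theorem tendsto_reducedResolvent (hd : d ≠ 0) (v : Fin d → ℝ) :
    Tendsto (reducedResolvent μ C r v) (𝓝[≠] (1 : ℂ)) (𝓝 (reducedResolventOne μ C r v)) :=
  tendsto_nhds_limUnder ⟨_, tendsto_inv_sub_smul (projPsi_mul_self hd)
    (meanTransfer_mul_projPsi μ hC hU r v) (projPsi_mul_meanTransfer μ hC hU r v)
    (det_meanTransfer_ne_zero μ hS hC hU hd v)⟩

theorem reducedResolventOne_eq (hd : d ≠ 0) (v : Fin d → ℝ) :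
    reducedResolventOne μ C r v =
      (meanTransfer μ C r (-v) v - projPsi d - 1)⁻¹ * (1 - projPsi d) :=
  (tendsto_inv_sub_smul (projPsi_mul_self hd)
    (meanTransfer_mul_projPsi μ hC hU r v) (projPsi_mul_meanTransfer μ hC hU r v)
    (det_meanTransfer_ne_zero μ hS hC hU hd v)).limUnder_eq

theorem reducedResolventOne_relations (hd : d ≠ 0) (v : Fin d → ℝ) :
    reducedResolventOne μ C r v * (meanTransfer μ C r (-v) v - 1) = 1 - projPsi d ∧
      reducedResolventOne μ C r v * projPsi d = 0 ∧
      projPsi d * reducedResolventOne μ C r v = 0 := by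
  rw [reducedResolventOne_eq μ hS hC hU hd]
  exact reduced_inverse_relations (projPsi_mul_self hd)
    (meanTransfer_mul_projPsi μ hC hU r v) (projPsi_mul_meanTransfer μ hC hU r v)
    (det_meanTransfer_ne_zero μ hS hC hU hd v)

end Resolvent

/-! ### The diffusion form as a second order perturbation coefficient -/

section SecondOrder

variable {d : ℕ} (r : Coin d → Lattice d) (y : Fin d → ℝ)

/-- The displacement `y r(τ)`. -/
def jump (τ : Coin d) : ℝ := ∑ j, y j * (r τ j : ℝ)

/-- The centred displacement `y r(τ) - y r̄`. -/
def centredJump (τ : Coin d) : ℝ := jump r y τ - drift r y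

/-- The multiplication by the centred displacement of the first factor. -/
def jumpMatrix : PairMatrix d := Matrix.diagonal fun T => (centredJump r y T.1 : ℂ)

theorem sum_jump (hd : d ≠ 0) : ∑ τ, jump r y τ = 2 * d * drift r y := by
  have hd' : (d : ℝ) ≠ 0 := by exact_mod_cast hd
  simp only [jump, drift, meanJump]
  rw [Finset.sum_comm, Finset.mul_sum]
  refine Finset.sum_congr rfl fun j _ => ?_
  rw [← Finset.mul_sum]
  field_simp

theorem sum_centredJump (hd : d ≠ 0) : ∑ τ, centredJump r y τ = 0 := by
  simp only [centredJump, Finset.sum_sub_distrib, sum_jump r y hd]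
  simp
  ring

theorem sum_centredJump_sq (hd : d ≠ 0) :
    ∑ τ, centredJump r y τ ^ 2 = ∑ τ, jump r y τ ^ 2 - 2 * d * drift r y ^ 2 := by
  have h : ∀ τ, centredJump r y τ ^ 2 =
      jump r y τ ^ 2 - 2 * drift r y * jump r y τ + drift r y ^ 2 := fun τ => by
    rw [centredJump]; ring
  simp only [h, Finset.sum_add_distrib, Finset.sum_sub_distrib, ← Finset.mul_sum,
    sum_jump r y hd]
  simp
  ring

theorem jumpMatrix_eq : jumpMatrix r y =
    Matrix.diagonal (fun T : Coin d × Coin d => (jump r y T.1 : ℂ)) -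
      (drift r y : ℂ) • (1 : PairMatrix d) := by
  rw [jumpMatrix, ← Matrix.diagonal_one, ← Matrix.diagonal_smul, Matrix.diagonal_sub]
  congr 1
  funext T
  simp [centredJump]

theorem sum_diagonal_pair (f : Coin d → ℂ) :
    ∑ σ, ∑ τ, (Matrix.diagonal (fun T : Coin d × Coin d => f T.1) : PairMatrix d) (σ, σ) (τ, τ) =
      ∑ σ, f σ := by
  refine Finset.sum_congr rfl fun σ _ => ?_
  rw [Finset.sum_eq_single σ]
  · rw [Matrix.diagonal_apply_eq]
  · intro τ _ h
    exact Matrix.diagonal_apply_ne _ fun h' => h (Prod.mk.inj h').1.symm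
  · simp

/-- The compressed first order term is the mean of the centred jumps, which is zero. -/
theorem projPsi_mul_jumpMatrix_mul_projPsi (hd : d ≠ 0) :
    projPsi d * jumpMatrix r y * projPsi d = 0 := by
  rw [projPsi_mul_mul_projPsi, jumpMatrix,
    sum_diagonal_pair fun τ => (centredJump r y τ : ℂ), ← Complex.ofReal_sum,
    sum_centredJump r y hd]
  simp

theorem projPsi_mul_jumpMatrix_sq_mul_projPsi (hd : d ≠ 0) :
    projPsi d * jumpMatrix r y * jumpMatrix r y * projPsi d =
      ((2 * d : ℂ)⁻¹ * ((∑ τ, (jump r y τ : ℂ) ^ 2) - 2 * d * (drift r y : ℂ) ^ 2)) •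
        projPsi d := by
  have h : jumpMatrix r y * jumpMatrix r y =
      Matrix.diagonal fun T : Coin d × Coin d => (centredJump r y T.1 : ℂ) ^ 2 := by
    simp only [jumpMatrix, Matrix.diagonal_mul_diagonal, sq]
  rw [mul_assoc (projPsi d), h, projPsi_mul_mul_projPsi,
    sum_diagonal_pair fun τ => (centredJump r y τ : ℂ) ^ 2]
  congr 2
  exact_mod_cast congrArg (fun x : ℝ => (x : ℂ)) (sum_centredJump_sq r y hd)

/-- The centring is a multiple of the identity and is killed by `S P = P S = 0`, so raw jumps may
replace centred ones around `S`. -/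
theorem projPsi_mul_jumpMatrix_conj_mul_projPsi {S : PairMatrix d} (hSP : S * projPsi d = 0)
    (hPS : projPsi d * S = 0) :
    projPsi d * jumpMatrix r y * S * jumpMatrix r y * projPsi d =
      ((2 * d : ℂ)⁻¹ * ∑ σ, ∑ τ, (jump r y σ : ℂ) * jump r y τ * S (σ, σ) (τ, τ)) • projPsi d := by
  set G : PairMatrix d := Matrix.diagonal fun T : Coin d × Coin d => (jump r y T.1 : ℂ) with hG
  have h1 : projPsi d * jumpMatrix r y * S = projPsi d * G * S := by
    rw [jumpMatrix_eq, mul_sub, sub_mul, mul_smul_comm, mul_one, smul_mul_assoc, hPS, smul_zero,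
      sub_zero]
  have h2 : S * jumpMatrix r y * projPsi d = S * G * projPsi d := by
    rw [jumpMatrix_eq, mul_sub, sub_mul, mul_smul_comm, mul_one, smul_mul_assoc, hSP, smul_zero,
      sub_zero]
  have h3 : projPsi d * jumpMatrix r y * S * jumpMatrix r y * projPsi d =
      projPsi d * (G * S * G) * projPsi d := by
    rw [h1]
    simp only [mul_assoc] at h2 ⊢
    rw [h2]
  rw [h3, projPsi_mul_mul_projPsi]
  congr 2
  refine Finset.sum_congr rfl fun σ _ => Finset.sum_congr rfl fun τ _ => ?_
  rw [hG, Matrix.mul_diagonal, Matrix.diagonal_mul]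
  ring

variable {Ω : Type*} [MeasurableSpace Ω] (μ : Measure Ω) (C : Ω → CoinMatrix d)

theorem sum_sum_jump (f : Coin d → Coin d → ℂ) :
    ∑ j, ∑ k, (y j : ℂ) * y k * ∑ τ, ∑ τ', (r τ j : ℂ) * (r τ' k : ℂ) * f τ τ' =
      ∑ τ, ∑ τ', (jump r y τ : ℂ) * jump r y τ' * f τ τ' := by
  have h : ∀ τ τ', (jump r y τ : ℂ) * jump r y τ' * f τ τ' =
      ∑ j, ∑ k, (y j : ℂ) * y k * ((r τ j : ℂ) * (r τ' k : ℂ) * f τ τ') := fun τ τ' => by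
    simp only [jump]
    push_cast
    rw [Finset.sum_mul_sum, Finset.sum_mul]
    refine Finset.sum_congr rfl fun j _ => ?_
    rw [Finset.sum_mul]
    exact Finset.sum_congr rfl fun k _ => by ring
  simp only [h, Finset.mul_sum]
  calc _ = ∑ j, ∑ τ, ∑ k, ∑ τ', (y j : ℂ) * y k * ((r τ j : ℂ) * (r τ' k : ℂ) * f τ τ') :=
        Finset.sum_congr rfl fun j _ => Finset.sum_comm
    _ = ∑ τ, ∑ j, ∑ k, ∑ τ', (y j : ℂ) * y k * ((r τ j : ℂ) * (r τ' k : ℂ) * f τ τ') :=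
        Finset.sum_comm
    _ = ∑ τ, ∑ j, ∑ τ', ∑ k, (y j : ℂ) * y k * ((r τ j : ℂ) * (r τ' k : ℂ) * f τ τ') :=
        Finset.sum_congr rfl fun τ _ => Finset.sum_congr rfl fun j _ => Finset.sum_comm
    _ = _ := Finset.sum_congr rfl fun τ _ => Finset.sum_comm

/-- Every term is put in the shape that `sum_sum_jump` contracts with `y`: the single sum becomes a
double sum with a Kronecker delta, and the symmetrisation is split in two. -/
theorem secondOrderMatrix_apply (v : Fin d → ℝ) (j k : Fin d) :
    secondOrderMatrix μ C r v j k = -(d : ℂ)⁻¹ *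
      (∑ τ, ∑ τ', (r τ j : ℂ) * (r τ' k : ℂ) * (if τ = τ' then 1 / 2 else 0) +
        ((∑ τ, ∑ τ', (r τ j : ℂ) * (r τ' k : ℂ) *
          ((reducedResolventOne μ C r v (τ, τ) (τ', τ') - (2 * d : ℂ)⁻¹) / 2)) +
        ∑ τ, ∑ τ', (r τ k : ℂ) * (r τ' j : ℂ) *
          ((reducedResolventOne μ C r v (τ, τ) (τ', τ') - (2 * d : ℂ)⁻¹) / 2))) := by
  rw [secondOrderMatrix, Matrix.of_apply]
  congr 2
  · refine Finset.sum_congr rfl fun τ _ => ?_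
    simp [div_eq_mul_inv]
  · rw [← Finset.sum_add_distrib]
    refine Finset.sum_congr rfl fun τ _ => ?_
    rw [← Finset.sum_add_distrib]
    exact Finset.sum_congr rfl fun τ' _ => by ring

/-- The constant `-1/(2d)` in the braces contributes `+2 (y r̄)²`, since the jumps sum to `2d (y
r̄)`. Subtracting `(y r̄)²` leaves `+(y r̄)²`. -/
theorem diffusionForm_eq (hd : d ≠ 0) (v : Fin d → ℝ) :
    diffusionForm μ C r v y = -(d : ℂ)⁻¹ * ((∑ τ, (jump r y τ : ℂ) ^ 2) / 2 +
      ∑ τ, ∑ τ', (jump r y τ : ℂ) * jump r y τ' * reducedResolventOne μ C r v (τ, τ) (τ', τ')) +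
      (drift r y : ℂ) ^ 2 := by
  have hd' : (d : ℂ) ≠ 0 := by exact_mod_cast hd
  set s : Coin d → Coin d → ℂ := fun τ τ' =>
    (reducedResolventOne μ C r v (τ, τ) (τ', τ') - (2 * d : ℂ)⁻¹) / 2 with hs
  have hform : diffusionForm μ C r v y =
      -(d : ℂ)⁻¹ * (∑ j, ∑ k, (y j : ℂ) * y k *
          ∑ τ, ∑ τ', (r τ j : ℂ) * (r τ' k : ℂ) * (if τ = τ' then 1 / 2 else 0) +
        (∑ j, ∑ k, (y j : ℂ) * y k * ∑ τ, ∑ τ', (r τ j : ℂ) * (r τ' k : ℂ) * s τ τ' +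
        ∑ j, ∑ k, (y j : ℂ) * y k * ∑ τ, ∑ τ', (r τ k : ℂ) * (r τ' j : ℂ) * s τ τ')) -
      ∑ j, ∑ k, (y j : ℂ) * meanJump r j * (y k * meanJump r k) := by
    simp only [← Finset.sum_add_distrib, Finset.mul_sum (a := -(d : ℂ)⁻¹),
      ← Finset.sum_sub_distrib]
    simp only [diffusionForm, diffusionMatrix, dotProduct, Matrix.mulVec]
    refine Finset.sum_congr rfl fun j _ => ?_
    rw [Finset.mul_sum]
    refine Finset.sum_congr rfl fun k _ => ?_
    rw [Matrix.sub_apply, secondOrderMatrix_apply, Matrix.of_apply]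
    push_cast
    ring
  have hsymm : ∑ j, ∑ k, (y j : ℂ) * y k * ∑ τ, ∑ τ', (r τ k : ℂ) * (r τ' j : ℂ) * s τ τ' =
      ∑ j, ∑ k, (y j : ℂ) * y k * ∑ τ, ∑ τ', (r τ j : ℂ) * (r τ' k : ℂ) * s τ τ' := by
    rw [Finset.sum_comm]
    refine Finset.sum_congr rfl fun j _ => Finset.sum_congr rfl fun k _ => ?_
    rw [mul_comm (y k : ℂ)]
  have hdiag : ∑ τ, ∑ τ', (jump r y τ : ℂ) * jump r y τ' * (if τ = τ' then 1 / 2 else 0) =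
      (∑ τ, (jump r y τ : ℂ) ^ 2) / 2 := by
    rw [Finset.sum_div]
    refine Finset.sum_congr rfl fun τ _ => ?_
    simp [sq, div_eq_mul_inv]
  have hjump : ∑ τ, ∑ τ', (jump r y τ : ℂ) * jump r y τ' = (2 * d * (drift r y : ℂ)) ^ 2 := by
    rw [← Finset.sum_mul_sum, ← Complex.ofReal_sum, sum_jump r y hd]
    push_cast
    ring
  have hs2 : ∑ τ, ∑ τ', (jump r y τ : ℂ) * jump r y τ' * s τ τ' =
      (∑ τ, ∑ τ', (jump r y τ : ℂ) * jump r y τ' *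
        reducedResolventOne μ C r v (τ, τ) (τ', τ')) / 2 -
      (2 * d : ℂ)⁻¹ / 2 * ∑ τ, ∑ τ', (jump r y τ : ℂ) * jump r y τ' := by
    simp only [Finset.sum_div, Finset.mul_sum, ← Finset.sum_sub_distrib, hs]
    exact Finset.sum_congr rfl fun τ _ => Finset.sum_congr rfl fun τ' _ => by ring
  have hdrift : ∑ j, ∑ k, (y j : ℂ) * meanJump r j * (y k * meanJump r k) =
      (drift r y : ℂ) ^ 2 := by
    rw [← Finset.sum_mul_sum, drift, sq]
    push_cast
    rfl
  rw [hform, hsymm, sum_sum_jump, sum_sum_jump, hdiag, hs2, hjump, hdrift]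
  field_simp
  ring

/-- `-½ ⟨y, 𝔻(v) y⟩` is the second order coefficient of the centred perturbation. -/
theorem diffusionForm_smul_projPsi (hd : d ≠ 0) (v : Fin d → ℝ)
    (hSP : reducedResolventOne μ C r v * projPsi d = 0)
    (hPS : projPsi d * reducedResolventOne μ C r v = 0) :
    (-(1 / 2) * diffusionForm μ C r v y) • projPsi d =
      (1 / 2 : ℂ) • (projPsi d * jumpMatrix r y * jumpMatrix r y * projPsi d) +
        projPsi d * jumpMatrix r y * reducedResolventOne μ C r v * jumpMatrix r y * projPsi d := by
  have hd' : (d : ℂ) ≠ 0 := by exact_mod_cast hd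
  rw [projPsi_mul_jumpMatrix_sq_mul_projPsi r y hd,
    projPsi_mul_jumpMatrix_conj_mul_projPsi r y hSP hPS, smul_smul, ← add_smul,
    diffusionForm_eq r y μ C hd]
  congr 1
  field_simp
  ring

end SecondOrder

/-! ### The scaling limit at fixed relative momentum -/

section Pointwise

theorem tendsto_exp_remainder (g : ℝ) {e : ℕ → ℝ} (he : Tendsto e atTop (𝓝 0)) :
    Tendsto (fun n => (Complex.exp (I * (e n * g : ℝ)) -
      (1 + I * e n * g - (e n : ℂ) ^ 2 / 2 * (g : ℂ) ^ 2)) / (e n : ℂ) ^ 2) atTop (𝓝 0) := by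
  refine squeeze_zero_norm (a := fun n => |e n| * (|g| ^ 3 * Real.exp (|e n| * |g|)))
    (fun n => ?_) ?_
  · have h := Complex.norm_exp_sub_sum_le_norm_mul_exp (I * (e n * g : ℝ)) 3
    have hsum : ∑ m ∈ Finset.range 3, (I * (e n * g : ℝ)) ^ m / (m.factorial : ℂ) =
        1 + I * e n * g - (e n : ℂ) ^ 2 / 2 * (g : ℂ) ^ 2 := by
      simp only [Finset.sum_range_succ, Finset.sum_range_zero, Nat.factorial]
      push_cast
      linear_combination ((e n : ℂ) * g) ^ 2 / 2 * I_sq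
    have hnorm : ‖I * ((e n * g : ℝ) : ℂ)‖ = |e n| * |g| := by
      rw [norm_mul, norm_I, one_mul, Complex.norm_real, Real.norm_eq_abs, abs_mul]
    rw [hsum, hnorm] at h
    rw [norm_div]
    refine div_le_of_le_mul₀ (norm_nonneg _) (by positivity) (h.trans (le_of_eq ?_))
    rw [norm_pow, Complex.norm_real, Real.norm_eq_abs]
    ring
  · have h1 : Tendsto (fun n => |e n|) atTop (𝓝 0) := by simpa using he.abs
    simpa using h1.mul (((Real.continuous_exp.tendsto _).comp (h1.mul_const |g|)).const_mul
      (|g| ^ 3))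

open scoped Matrix.Norms.L2Operator

variable {d : ℕ} {Ω : Type*} [MeasurableSpace Ω] (μ : Measure Ω) [IsProbabilityMeasure μ]
  {C : Ω → CoinMatrix d} {r : Coin d → Lattice d}

/-- The centred phase matrix `e^{i ε (y r(τ) - y r̄)}`. -/
def centredPhase (r : Coin d → Lattice d) (y : Fin d → ℝ) (e : ℝ) : PairMatrix d :=
  Matrix.diagonal fun T => Complex.exp (I * (e * centredJump r y T.1 : ℝ))

theorem opNorm_centredPhase_le_one (y : Fin d → ℝ) (e : ℝ) : ‖centredPhase r y e‖ ≤ 1 :=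
  opNorm_diagonal_le_one fun T => by rw [mul_comm, Complex.norm_exp_ofReal_mul_I]

omit [IsProbabilityMeasure μ] in
-- The centring factor is distributed one phase per step. The perturbation enters only the first
-- momentum, so it splits off on the left as a diagonal matrix.
theorem exp_drift_smul_meanTransfer (y v : Fin d → ℝ) (e : ℝ) :
    Complex.exp (-(I * (e * drift r y : ℝ))) • meanTransfer μ C r (e • y + -v) v =
      centredPhase r y e * meanTransfer μ C r (-v) v := by
  rw [meanTransfer, meanTransfer, ← mul_assoc, ← smul_mul_assoc]
  congr 1
  rw [phaseMatrix, phaseMatrix, centredPhase, Matrix.diagonal_mul_diagonal,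
    ← Matrix.diagonal_smul]
  congr 1
  funext T
  have h : Complex.exp (-(I * (e * drift r y : ℝ))) * phase (e • y) (r T.1) =
      Complex.exp (I * (e * centredJump r y T.1 : ℝ)) := by
    rw [phase, ← Complex.exp_add, centredJump, jump]
    congr 1
    simp only [Pi.smul_apply, smul_eq_mul, mul_assoc, ← Finset.mul_sum]
    push_cast
    ring
  rw [Pi.smul_apply, smul_eq_mul, phase_add_left, ← h]
  ring

theorem tendsto_centredPhase_remainder (y : Fin d → ℝ) {e : ℕ → ℝ}
    (he : Tendsto e atTop (𝓝 0)) : ∃ Rem : ℕ → PairMatrix d, Tendsto Rem atTop (𝓝 0) ∧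
      ∀ n, centredPhase r y (e n) = 1 + (I * e n) • jumpMatrix r y -
        ((e n : ℂ) ^ 2 / 2) • (jumpMatrix r y * jumpMatrix r y) + (e n : ℂ) ^ 2 • Rem n := by
  refine ⟨fun n => Matrix.diagonal fun T => (Complex.exp (I * (e n * centredJump r y T.1 : ℝ)) -
      (1 + I * e n * centredJump r y T.1 -
        (e n : ℂ) ^ 2 / 2 * (centredJump r y T.1 : ℂ) ^ 2)) / (e n : ℂ) ^ 2, ?_, fun n => ?_⟩
  · have h : Tendsto (fun (n : ℕ) (T : Coin d × Coin d) =>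
        (Complex.exp (I * (e n * centredJump r y T.1 : ℝ)) -
        (1 + I * e n * centredJump r y T.1 -
          (e n : ℂ) ^ 2 / 2 * (centredJump r y T.1 : ℂ) ^ 2)) / (e n : ℂ) ^ 2) atTop (𝓝 0) :=
      tendsto_pi_nhds.2 fun T => tendsto_exp_remainder _ he
    have h2 := ((continuous_id.matrix_diagonal (n := Coin d × Coin d) (R := ℂ)).tendsto 0).comp h
    refine (h2.congr fun n => rfl).trans (le_of_eq ?_)
    simp only [id_eq, Matrix.diagonal_zero']
  · rw [jumpMatrix, Matrix.diagonal_mul_diagonal, ← Matrix.diagonal_one, ← Matrix.diagonal_smul,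
      ← Matrix.diagonal_smul, ← Matrix.diagonal_smul, Matrix.diagonal_add, Matrix.diagonal_sub,
      Matrix.diagonal_add, centredPhase]
    congr 1
    funext T
    simp only [Pi.smul_apply, smul_eq_mul]
    rcases eq_or_ne (e n) 0 with h | h
    · simp [h]
    · have : (e n : ℂ) ≠ 0 := by exact_mod_cast h
      field_simp
      ring

variable (hS : AssumptionS μ C r) (hC : ∀ σ τ, Measurable fun ω => C ω σ τ)
  (hU : ∀ ω, C ω ∈ Matrix.unitaryGroup (Coin d) ℂ)
  {ρ₀ : WalkSpace d →L[ℂ] WalkSpace d}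
  (hρ : ∀ σ τ, Summable fun p : Lattice d × Lattice d => ‖kernel ρ₀ p.1 p.2 σ τ‖)

include hS hC hU hρ in
-- `⟨Ψ₁| P = ⟨Ψ₁|` allows `P` to be inserted before the power, so the perturbation limit applies.
-- The initial vector converges by continuity of `fourierVec`.
theorem tendsto_centred_integrand (hd : d ≠ 0) (y v : Fin d → ℝ) {e : ℕ → ℝ}
    (he : Tendsto e atTop (𝓝 0)) {N : ℕ → ℕ} {κ : ℝ}
    (hN : Tendsto (fun n => N n * e n ^ 2) atTop (𝓝 κ)) :
    Tendsto (fun n => Complex.exp (-(I * N n * (e n * drift r y : ℝ))) *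
        (star (psiOne d) ⬝ᵥ (meanTransfer μ C r (e n • y + -v) v ^ N n *ᵥ
          fourierVec ρ₀ (e n • y + -v) v))) atTop
      (𝓝 (Complex.exp (-(κ / 2) * diffusionForm μ C r v y) *
        (star (psiOne d) ⬝ᵥ fourierVec ρ₀ (-v) v))) := by
  obtain ⟨hSM, hSP, hPS⟩ := reducedResolventOne_relations μ hS hC hU hd v
  obtain ⟨Rem, hRem, hexp⟩ := tendsto_centredPhase_remainder (r := r) y he
  have hpow := tendsto_mul_pow_of_perturbation (projPsi_mul_meanTransfer μ hC hU r v)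
    (meanTransfer_mul_projPsi μ hC hU r v) hSM (projPsi_mul_jumpMatrix_mul_projPsi r y hd)
    (diffusionForm_smul_projPsi r y μ C hd v hSP hPS) (opNorm_meanTransfer_le_one μ hC hU r _ _)
    he (fun n => opNorm_centredPhase_le_one y (e n)) hRem hexp hN
  have hvec : Tendsto (fun n => fourierVec ρ₀ (e n • y + -v) v) atTop
      (𝓝 (fourierVec ρ₀ (-v) v)) := by
    have hline : Continuous fun e : ℝ => e • y + -v := by fun_prop
    have h := (continuous_fourierVec hline (continuous_const (y := v)) hρ).tendsto 0
    rw [zero_smul, zero_add] at h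
    exact h.comp he
  have hcont : Continuous fun q : PairMatrix d × (Coin d × Coin d → ℂ) =>
      star (psiOne d) ⬝ᵥ (q.1 *ᵥ q.2) := by fun_prop
  have hlim := (hcont.tendsto _).comp (hpow.prodMk_nhds hvec)
  have hP : ∀ w, star (psiOne d) ⬝ᵥ (projPsi d *ᵥ w) = star (psiOne d) ⬝ᵥ w := fun w => by
    rw [Matrix.dotProduct_mulVec, psiOne_vecMul_projPsi hd]
  have hval : star (psiOne d) ⬝ᵥ ((Complex.exp (κ * (-(1 / 2) * diffusionForm μ C r v y)) •
      projPsi d) *ᵥ fourierVec ρ₀ (-v) v) =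
      Complex.exp (-(κ / 2) * diffusionForm μ C r v y) *
        (star (psiOne d) ⬝ᵥ fourierVec ρ₀ (-v) v) := by
    rw [Matrix.smul_mulVec, dotProduct_smul, hP, smul_eq_mul]
    congr 2
    ring
  rw [← hval]
  refine hlim.congr fun n => ?_
  simp only [Function.comp]
  rw [← exp_drift_smul_meanTransfer, smul_pow, mul_smul_comm, Matrix.smul_mulVec,
    dotProduct_smul, ← Matrix.mulVec_mulVec, hP, smul_eq_mul, ← Complex.exp_nat_mul]
  congr 2
  ring

end Pointwise

/-! ### Scaling limits of the characteristic function -/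

section Scaling

variable {d : ℕ} {Ω : Type*} [MeasurableSpace Ω] (μ : Measure Ω)
  {C : Ω → CoinMatrix d} {r : Coin d → Lattice d} {ρ₀ : WalkSpace d →L[ℂ] WalkSpace d}

theorem continuous_meanTransfer (w : Fin d → ℝ) :
    Continuous fun v : Fin d → ℝ => meanTransfer μ C r (w + -v) v := by
  unfold meanTransfer phaseMatrix
  refine Continuous.matrix_mul (Continuous.matrix_diagonal ?_) continuous_const
  refine continuous_pi fun T => Continuous.mul ?_ (continuous_phase _)
  exact (continuous_phase (r T.1)).comp (continuous_const.add continuous_neg)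

theorem continuous_psiOne_dotProduct
    (hρ : ∀ σ τ, Summable fun p : Lattice d × Lattice d => ‖kernel ρ₀ p.1 p.2 σ τ‖)
    (w : Fin d → ℝ) (n : ℕ) :
    Continuous fun v : Fin d → ℝ =>
      star (psiOne d) ⬝ᵥ (meanTransfer μ C r (w + -v) v ^ n *ᵥ fourierVec ρ₀ (w + -v) v) := by
  have h1 : Continuous fun v : Fin d → ℝ => w + -v := by fun_prop
  have h2 := continuous_fourierVec h1 continuous_id hρ
  exact Continuous.dotProduct continuous_const
    (((continuous_meanTransfer μ w).pow n).matrix_mulVec h2)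

theorem psiOne_dotProduct_fourierVec (y y' : Fin d → ℝ) :
    star (psiOne d) ⬝ᵥ fourierVec ρ₀ y y' = (fourierKernel ρ₀ y y').trace :=
  psiOne_dotProduct _

/-- For `d = 0` there is no coin label, so every trace is zero; unit trace thus supplies `d ≥ 1`. -/
theorem ne_zero_of_isDensityMatrix (hρ₀ : IsDensityMatrix ρ₀) : d ≠ 0 := by
  rintro rfl
  have h : HasSum (fun x : Lattice 0 => (kernel ρ₀ x x).trace) 0 := by
    simp only [Matrix.trace, Finset.univ_eq_empty, Finset.sum_empty]
    exact hasSum_zero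
  exact one_ne_zero (hρ₀.hasTrace_one.unique h)

variable [IsProbabilityMeasure μ] (hC : ∀ σ τ, Measurable fun ω => C ω σ τ)
  (hU : ∀ ω, C ω ∈ Matrix.unitaryGroup (Coin d) ℂ)

include μ hC hU

/-- The bound depends on neither `n` nor the momenta, as dominated convergence requires. -/
theorem norm_psiOne_dotProduct_le
    (hρ : ∀ σ τ, Summable fun p : Lattice d × Lattice d => ‖kernel ρ₀ p.1 p.2 σ τ‖)
    (y y' : Fin d → ℝ) (n : ℕ) :
    ‖star (psiOne d) ⬝ᵥ (meanTransfer μ C r y y' ^ n *ᵥ fourierVec ρ₀ y y')‖ ≤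
      ∑ _τ : Coin d, ∑ T : Coin d × Coin d,
        ∑' p : Lattice d × Lattice d, ‖kernel ρ₀ p.1 p.2 T.1 T.2‖ := by
  rw [psiOne_dotProduct]
  refine (norm_sum_le _ _).trans (Finset.sum_le_sum fun τ _ => ?_)
  refine (norm_sum_le _ _).trans (Finset.sum_le_sum fun T _ => ?_)
  rw [norm_mul]
  exact (mul_le_of_le_one_left (norm_nonneg _)
    (norm_meanTransfer_pow_entry_le_one μ hC hU r y y' n _ T)).trans (norm_fourierVec_le hρ y y' T)

theorem torusIntegral_psiOne_dotProduct (hρ₀ : IsDensityMatrix ρ₀)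
    (hρ : ∀ σ τ, Summable fun p : Lattice d × Lattice d => ‖kernel ρ₀ p.1 p.2 σ τ‖) :
    torusIntegral (fun v => star (psiOne d) ⬝ᵥ fourierVec ρ₀ (-v) v) = 1 := by
  -- Time `0` and momentum `0` reduce the representation to the trace of `ρ₀`; the jump function
  -- plays no role at time `0` and is taken to be `0`.
  have h := charFn_eq_torusIntegral μ hC hU 0 hρ 0 0
  simp only [pow_zero, Matrix.one_mulVec, zero_add] at h
  rw [← h, charFn, ← hρ₀.hasTrace_one.tsum_eq]
  refine tsum_congr fun z => ?_
  rw [averagedProb_eq μ hC hU, phase_zero_left, mul_one]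
  simp only [averagedKernel_zero]
  rfl

/-- Both scalings are instances, with `κ = 0` or `κ = t`. -/
theorem tendsto_charFn_of_tendsto (hS : AssumptionS μ C r) (hd : d ≠ 0)
    (hρ : ∀ σ τ, Summable fun p : Lattice d × Lattice d => ‖kernel ρ₀ p.1 p.2 σ τ‖)
    (y : Fin d → ℝ) {e : ℕ → ℝ} (he : Tendsto e atTop (𝓝 0)) {N : ℕ → ℕ} {κ : ℝ}
    (hN : Tendsto (fun n => N n * e n ^ 2) atTop (𝓝 κ)) :
    IntegrableOn (fun v => Complex.exp (-(κ / 2) * diffusionForm μ C r v y) *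
        (star (psiOne d) ⬝ᵥ fourierVec ρ₀ (-v) v)) (torusBox d) ∧
      Tendsto (fun n => Complex.exp (-(I * N n * (e n * drift r y : ℝ))) *
          charFn μ C r ρ₀ (N n) (e n • y)) atTop
        (𝓝 (torusIntegral fun v => Complex.exp (-(κ / 2) * diffusionForm μ C r v y) *
          (star (psiOne d) ⬝ᵥ fourierVec ρ₀ (-v) v))) := by
  let F : ℕ → (Fin d → ℝ) → ℂ := fun n v =>
    Complex.exp (-(I * N n * (e n * drift r y : ℝ))) *
      (star (psiOne d) ⬝ᵥ (meanTransfer μ C r (e n • y + -v) v ^ N n *ᵥ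
        fourierVec ρ₀ (e n • y + -v) v))
  let K : ℝ := ∑ _τ : Coin d, ∑ T : Coin d × Coin d,
    ∑' p : Lattice d × Lattice d, ‖kernel ρ₀ p.1 p.2 T.1 T.2‖
  have hFmeas : ∀ n, AEStronglyMeasurable (F n) (volume.restrict (torusBox d)) := fun n =>
    (continuous_const.mul (continuous_psiOne_dotProduct μ hρ _ _)).aestronglyMeasurable
  have hFK : ∀ n v, ‖F n v‖ ≤ K := fun n v => by
    have h1 : ‖Complex.exp (-(I * N n * (e n * drift r y : ℝ)))‖ = 1 := by
      rw [← Complex.norm_exp_ofReal_mul_I (-(N n * (e n * drift r y)))]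
      congr 2
      push_cast
      ring
    simp only [F]
    rw [norm_mul, h1, one_mul]
    exact norm_psiOne_dotProduct_le μ hC hU hρ _ _ _
  have hlim : ∀ v, Tendsto (fun n => F n v) atTop
      (𝓝 (Complex.exp (-(κ / 2) * diffusionForm μ C r v y) *
        (star (psiOne d) ⬝ᵥ fourierVec ρ₀ (-v) v))) := fun v =>
    tendsto_centred_integrand μ hS hC hU hρ hd y v he hN
  refine ⟨?_, ?_⟩
  -- The limit inherits the uniform bound `K`, so integrability needs no sign information on the
  -- diffusion form.
  · refine Integrable.of_bound (aestronglyMeasurable_of_tendsto_ae atTop hFmeas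
      (ae_of_all _ hlim)) K (ae_of_all _ fun v => ?_)
    exact le_of_tendsto (hlim v).norm (Eventually.of_forall fun n => hFK n v)
  · have h := tendsto_integral_of_dominated_convergence (fun _ => K) hFmeas
      (integrable_const K) (fun n => ae_of_all _ (hFK n)) (ae_of_all _ hlim)
    refine (h.const_mul (((2 * Real.pi : ℝ) : ℂ) ^ d)⁻¹).congr fun n => ?_
    rw [charFn_eq_torusIntegral μ hC hU r hρ, torusIntegral, integral_const_mul]
    ring

end Scaling

theorem tendsto_floor_mul_div {t : ℝ} (ht : 0 ≤ t) :
    Tendsto (fun n : ℕ => (⌊t * n⌋₊ : ℝ) / n) atTop (𝓝 t) :=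
  (tendsto_nat_floor_mul_div_atTop ht).comp tendsto_natCast_atTop_atTop

end

end QuantumWalk

/-! ### The ballistic and diffusive limits -/

theorem mainTheorem2 {d : ℕ} {Ω : Type*} [MeasurableSpace Ω] (μ : Measure Ω)
    [IsProbabilityMeasure μ] (C : Ω → QuantumWalk.CoinMatrix d)
    (hC_meas : ∀ σ τ, Measurable fun ω => C ω σ τ)
    (hC_unitary : ∀ ω, C ω ∈ Matrix.unitaryGroup (QuantumWalk.Coin d) ℂ)
    (r : QuantumWalk.Coin d → QuantumWalk.Lattice d)
    (hS : QuantumWalk.AssumptionS μ C r)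
    (ρ₀ : QuantumWalk.WalkSpace d →L[ℂ] QuantumWalk.WalkSpace d)
    (hρ₀ : QuantumWalk.IsDensityMatrix ρ₀)
    (hρ₀_summable : ∀ σ τ, Summable fun p : QuantumWalk.Lattice d × QuantumWalk.Lattice d =>
      ‖QuantumWalk.kernel ρ₀ p.1 p.2 σ τ‖) :
    -- the limit defining `S_v(1)` exists
    (∀ v : Fin d → ℝ, Tendsto (QuantumWalk.reducedResolvent μ C r v) (𝓝[≠] (1 : ℂ))
      (𝓝 (QuantumWalk.reducedResolventOne μ C r v))) ∧
    -- the series for `R₀(-v,v)`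
    (∀ v : Fin d → ℝ,
      HasSum (fun p : QuantumWalk.Lattice d × QuantumWalk.Lattice d =>
          QuantumWalk.phase v p.2 • QuantumWalk.kernel ρ₀ p.1 (p.1 + p.2))
        (QuantumWalk.fourierKernel ρ₀ (-v) v)) ∧
    ∀ t : ℝ, 0 ≤ t → ∀ y : Fin d → ℝ,
      -- ballistic scaling
      Tendsto (fun n : ℕ => QuantumWalk.charFn μ C r ρ₀ ⌊t * n⌋₊ (fun j => y j / n)) atTop
        (𝓝 (Complex.exp (I * t * QuantumWalk.drift r y))) ∧
      -- diffusive scaling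
      IntegrableOn (fun v => Complex.exp (-(t / 2) * QuantumWalk.diffusionForm μ C r v y) *
        (QuantumWalk.fourierKernel ρ₀ (-v) v).trace) (QuantumWalk.torusBox d) ∧
      Tendsto (fun n : ℕ =>
          Complex.exp (-(I * (⌊t * n⌋₊ : ℂ) * ((QuantumWalk.drift r y / Real.sqrt n : ℝ) : ℂ))) *
            QuantumWalk.charFn μ C r ρ₀ ⌊t * n⌋₊ (fun j => y j / Real.sqrt n)) atTop
        (𝓝 (QuantumWalk.torusIntegral fun v =>
          Complex.exp (-(t / 2) * QuantumWalk.diffusionForm μ C r v y) *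
            (star (QuantumWalk.psiOne d) ⬝ᵥ QuantumWalk.fourierVec ρ₀ (-v) v))) ∧
      (QuantumWalk.torusIntegral fun v =>
          Complex.exp (-(t / 2) * QuantumWalk.diffusionForm μ C r v y) *
            (star (QuantumWalk.psiOne d) ⬝ᵥ QuantumWalk.fourierVec ρ₀ (-v) v)) =
        QuantumWalk.torusIntegral fun v =>
          Complex.exp (-(t / 2) * QuantumWalk.diffusionForm μ C r v y) *
            (QuantumWalk.fourierKernel ρ₀ (-v) v).trace := by
  have hd := QuantumWalk.ne_zero_of_isDensityMatrix hρ₀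
  refine ⟨QuantumWalk.tendsto_reducedResolvent μ hS hC_meas hC_unitary hd,
    QuantumWalk.hasSum_fourierKernel hρ₀_summable, fun t ht y => ?_⟩
  have hfloor := QuantumWalk.tendsto_floor_mul_div ht
  have hinv : Tendsto (fun n : ℕ => (n : ℝ)⁻¹) atTop (𝓝 0) :=
    tendsto_inv_atTop_zero.comp tendsto_natCast_atTop_atTop
  have hsqrt : Tendsto (fun n : ℕ => (Real.sqrt n)⁻¹) atTop (𝓝 0) :=
    tendsto_inv_atTop_zero.comp (Real.tendsto_sqrt_atTop.comp tendsto_natCast_atTop_atTop)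
  have hN1 : Tendsto (fun n : ℕ => (⌊t * n⌋₊ : ℝ) * (n : ℝ)⁻¹ ^ 2) atTop (𝓝 0) := by
    have h := hfloor.mul hinv
    rw [mul_zero] at h
    exact h.congr fun n => by ring
  have hN2 : Tendsto (fun n : ℕ => (⌊t * n⌋₊ : ℝ) * (Real.sqrt n)⁻¹ ^ 2) atTop (𝓝 t) := by
    refine hfloor.congr fun n => ?_
    rw [inv_pow, Real.sq_sqrt n.cast_nonneg, div_eq_mul_inv]
  have hball := (QuantumWalk.tendsto_charFn_of_tendsto μ hC_meas hC_unitary hS hd hρ₀_summable y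
    hinv hN1).2
  have hdiff := QuantumWalk.tendsto_charFn_of_tendsto μ hC_meas hC_unitary hS hd hρ₀_summable y
    hsqrt hN2
  refine ⟨?_, ?_, ?_, ?_⟩
  · have hone : (QuantumWalk.torusIntegral fun v =>
        Complex.exp (-(((0 : ℝ) : ℂ) / 2) * QuantumWalk.diffusionForm μ C r v y) *
          (star (QuantumWalk.psiOne d) ⬝ᵥ QuantumWalk.fourierVec ρ₀ (-v) v)) = 1 := by
      simp only [Complex.ofReal_zero, zero_div, neg_zero, zero_mul, Complex.exp_zero, one_mul]
      exact QuantumWalk.torusIntegral_psiOne_dotProduct μ hC_meas hC_unitary hρ₀ hρ₀_summable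
    rw [hone] at hball
    -- The drift phase removed by the centring is restored; its exponent converges because `⌊t n⌋ /
    -- n → t`.
    have hphase : Tendsto (fun n : ℕ => Complex.exp
        (I * (⌊t * n⌋₊ : ℂ) * ((n : ℝ)⁻¹ * QuantumWalk.drift r y : ℝ))) atTop
        (𝓝 (Complex.exp (I * t * QuantumWalk.drift r y))) := by
      refine (Complex.continuous_exp.tendsto _).comp ?_
      have h := (((Complex.continuous_ofReal.tendsto t).comp hfloor).const_mul I).mul_const
        (QuantumWalk.drift r y : ℂ)
      refine h.congr fun n => ?_
      simp only [Function.comp]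
      push_cast
      ring
    have h := hphase.mul hball
    rw [mul_one] at h
    refine h.congr fun n => ?_
    have hy : (fun j => y j / (n : ℝ)) = (n : ℝ)⁻¹ • y := by
      funext j
      rw [Pi.smul_apply, smul_eq_mul, div_eq_inv_mul]
    rw [hy, ← mul_assoc, ← Complex.exp_add, add_neg_cancel, Complex.exp_zero, one_mul]
  · have h := hdiff.1
    simp only [QuantumWalk.psiOne_dotProduct_fourierVec] at h
    exact h
  · refine hdiff.2.congr fun n => ?_
    have hy : (fun j => y j / Real.sqrt n) = (Real.sqrt n)⁻¹ • y := by
      funext j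
      rw [Pi.smul_apply, smul_eq_mul, div_eq_inv_mul]
    rw [hy, div_eq_inv_mul]
  · simp only [QuantumWalk.psiOne_dotProduct_fourierVec]
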